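/- Let $(W,S)$ be a Coxeter system, possibly of infinite rank, with $S=\{s_i\}_{i\in I}$ and Coxeter matrix $(m_{ij})_{i,j\in I}$, $m_{ij}\in\mathbb{N}_{\ge 1}\cup\{\infty\}$. Let $\Gamma$ be the graph with vertex set $S$ and with a directed edge $y_{ij}=[s_is_j]$ for each ordered pair $(i,j)$ with $i\neq j$ and $m_{ij}\ge 3$ (including $m_{ij}=\infty$). Let $P=\mathbb{Z}\Gamma$ be its (possibly non-unital) path algebra: it is the free $\mathbb{Z}$-module on all finite paths $[s_{i_0}s_{i_1}\cdots s_{i_n}]$, $n\ge 0$, in $\Gamma$, and the product of two paths is their concatenation if the first ends where the second starts, and $0$ otherwise. For $3\le m<\infty$ let $C_m(t)\in\mathbb{Z}[t]$ be the minimal polynomial of $4\cos^2(\pi/m)$. Let $I_{W,S}$ be the two-sided ideal of $P$ generated by the elements $C_{m_{ij}}([s_is_js_i])$ for all ordered pairs $(i,j)$ with $i\ne j$ and $3\le m_{ij}<\infty$, where the polynomial is evaluated in the ring $[s_i]P[s_i]$ with identity element $[s_i]$. Let $R_{W,S}=P/I_{W,S}$ (the strict universal coefficient ring of $(W,S)$),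 and write $[s_i]$ also for the image of the length-zero path $[s_i]$ in $R_{W,S}$. Then $R_{W,S}$ is nearly a domain, in the following sense: for all $i,j,k\in I$, if $x_1\in[s_i]R_{W,S}[s_j]$ and $x_2\in[s_j]R_{W,S}[s_k]$ satisfy $x_1x_2=0$, then $x_1=0$ or $x_2=0$. -/

import Mathlib

noncomputable section

/-! ### Path algebras of combinatorial graphs -/

/-- A path (of any finite length, including length zero) in a combinatorial graph, i.e. a graph
without loops and multiple edges: an origin, a terminus, and a sequence of successive adjacent
vertices leading from one to the other (backtracking is allowed). -/
structure GraphPath {V : Type*} (G : SimpleGraph V) where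
  origin : V
  terminus : V
  walk : G.Walk origin terminus

/-- Concatenation of composable paths. -/
def GraphPath.concat {V : Type*} {G : SimpleGraph V} (p q : GraphPath G)
    (h : p.terminus = q.origin) : GraphPath G :=
  ⟨p.origin, q.terminus, p.walk.append (q.walk.copy h.symm rfl)⟩

theorem GraphPath.concat_assoc {V : Type*} {G : SimpleGraph V} (p q r : GraphPath G)
    (h : p.terminus = q.origin) (h' : q.terminus = r.origin) :
    (p.concat q h).concat r h' = p.concat (q.concat r h') h := by
  obtain ⟨a, b, p⟩ := p
  obtain ⟨c, d, q⟩ := q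
  obtain ⟨e, f, r⟩ := r
  dsimp only at h h'
  subst h h'
  simp [GraphPath.concat, SimpleGraph.Walk.append_assoc]

/-- The path algebra `AΓ`: the free `A`-module on the set of paths of `Γ`. -/
def PathAlgebra (A : Type*) [CommRing A] {V : Type*} (G : SimpleGraph V) : Type _ :=
  GraphPath G →₀ A

namespace PathAlgebra

section

variable {A : Type*} [CommRing A] {V : Type*} {G : SimpleGraph V}

instance : AddCommGroup (PathAlgebra A G) := inferInstanceAs (AddCommGroup (GraphPath G →₀ A))

instance : Module A (PathAlgebra A G) := inferInstanceAs (Module A (GraphPath G →₀ A))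

/-- The multiple `a p` of a path `p`. -/
def single (p : GraphPath G) (a : A) : PathAlgebra A G := Finsupp.single p a

/-- The product `(a p) (b q)`: it is `a b` times the concatenation of `p` and `q` if `p` ends where
`q` starts, and `0` otherwise. -/
def mulSingle (p : GraphPath G) (a : A) (q : GraphPath G) (b : A) : PathAlgebra A G :=
  open Classical in
  if h : p.terminus = q.origin then single (p.concat q h) (a * b) else 0

/-- Multiplication of the path algebra: concatenation of paths, extended bilinearly. -/
instance : Mul (PathAlgebra A G) where
  mul f g := Finsupp.sum f fun p a => Finsupp.sum g fun q b => mulSingle p a q b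

theorem mul_def (f g : PathAlgebra A G) :
    f * g = Finsupp.sum f fun p a => Finsupp.sum g fun q b => mulSingle p a q b := rfl

theorem single_zero (p : GraphPath G) : single p (0 : A) = 0 := Finsupp.single_zero p

theorem single_add (p : GraphPath G) (a b : A) : single p (a + b) = single p a + single p b :=
  Finsupp.single_add p a b

@[elab_as_elim]
theorem induction_on {motive : PathAlgebra A G → Prop} (f : PathAlgebra A G)
    (zero : motive 0) (add : ∀ f g, motive f → motive g → motive (f + g))
    (single : ∀ p a, motive (single p a)) : motive f :=
  Finsupp.induction_linear f zero add single

theorem mulSingle_zero_left (p q : GraphPath G) (b : A) : mulSingle p 0 q b = 0 := by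
  unfold mulSingle; split_ifs <;> simp [single_zero]

theorem mulSingle_zero_right (p q : GraphPath G) (a : A) : mulSingle p a q 0 = 0 := by
  unfold mulSingle; split_ifs <;> simp [single_zero]

theorem mulSingle_add_left (p q : GraphPath G) (a a' b : A) :
    mulSingle p (a + a') q b = mulSingle p a q b + mulSingle p a' q b := by
  unfold mulSingle; split_ifs <;> simp [single_add, add_mul]

theorem mulSingle_add_right (p q : GraphPath G) (a b b' : A) :
    mulSingle p a q (b + b') = mulSingle p a q b + mulSingle p a q b' := by
  unfold mulSingle; split_ifs <;> simp [single_add, mul_add]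

theorem single_mul_single (p q : GraphPath G) (a b : A) :
    single p a * single q b = mulSingle p a q b := by
  rw [mul_def, single, single, Finsupp.sum_single_index, Finsupp.sum_single_index]
  · exact mulSingle_zero_right p q a
  · simp [mulSingle_zero_left]

theorem single_mul_single_of_eq (p q : GraphPath G) (a b : A) (h : p.terminus = q.origin) :
    single p a * single q b = single (p.concat q h) (a * b) := by
  rw [single_mul_single, mulSingle, dif_pos h]

theorem single_mul_single_of_ne (p q : GraphPath G) (a b : A) (h : p.terminus ≠ q.origin) :
    single p a * single q b = 0 := by
  rw [single_mul_single, mulSingle, dif_neg h]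

instance : NonUnitalNonAssocRing (PathAlgebra A G) where
  zero_mul f := by rw [mul_def]; exact Finsupp.sum_zero_index
  mul_zero f := by
    rw [mul_def]
    exact Finset.sum_eq_zero fun p _ => Finsupp.sum_zero_index
  left_distrib f g h := by
    simp only [mul_def]
    refine Eq.trans (Finset.sum_congr rfl fun p _ => ?_) Finset.sum_add_distrib
    exact Finsupp.sum_add_index' (fun q => mulSingle_zero_right p q _)
      fun q => mulSingle_add_right p q _
  right_distrib f g h := by
    simp only [mul_def]
    refine Finsupp.sum_add_index' (fun p => ?_) fun p a a' => ?_
    · exact Finset.sum_eq_zero fun q _ => mulSingle_zero_left p q _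
    · exact (Finset.sum_congr rfl fun q _ => mulSingle_add_left p q a a' _).trans
        Finset.sum_add_distrib

theorem single_mul_assoc (p q r : GraphPath G) (a b c : A) :
    single p a * single q b * single r c = single p a * (single q b * single r c) := by
  by_cases h : p.terminus = q.origin
  · by_cases h' : q.terminus = r.origin
    · rw [single_mul_single_of_eq p q a b h, single_mul_single_of_eq q r b c h',
        single_mul_single_of_eq _ _ _ _ (show (p.concat q h).terminus = r.origin from h'),
        single_mul_single_of_eq _ _ _ _ (show p.terminus = (q.concat r h').origin from h),
        GraphPath.concat_assoc, mul_assoc]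
    · rw [single_mul_single_of_eq p q a b h, single_mul_single_of_ne q r b c h', mul_zero,
        single_mul_single_of_ne _ _ _ _ (show (p.concat q h).terminus ≠ r.origin from h')]
  · rw [single_mul_single_of_ne p q a b h, zero_mul]
    by_cases h' : q.terminus = r.origin
    · rw [single_mul_single_of_eq q r b c h',
        single_mul_single_of_ne _ _ _ _ (show p.terminus ≠ (q.concat r h').origin from h)]
    · rw [single_mul_single_of_ne q r b c h', mul_zero]

instance : NonUnitalRing (PathAlgebra A G) where
  mul_assoc f g h := by
    induction f using PathAlgebra.induction_on with
    | zero => simp only [zero_mul]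
    | add f₁ f₂ h₁ h₂ => simp only [add_mul, h₁, h₂]
    | single p a =>
      induction g using PathAlgebra.induction_on with
      | zero => simp only [zero_mul, mul_zero]
      | add g₁ g₂ h₁ h₂ => simp only [add_mul, mul_add, h₁, h₂]
      | single q b =>
        induction h using PathAlgebra.induction_on with
        | zero => simp only [mul_zero]
        | add k₁ k₂ h₁ h₂ => simp only [mul_add, h₁, h₂]
        | single r c => exact single_mul_assoc p q r a b c

variable (A) in
/-- The path `[s]` of length zero at the vertex `s`. -/
def vertex (s : V) : PathAlgebra A G := single ⟨s, s, SimpleGraph.Walk.nil⟩ 1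

variable (A) in
/-- The edge `[s t]`, as a path of length one. -/
def edge {s t : V} (h : G.Adj s t) : PathAlgebra A G :=
  single ⟨s, t, SimpleGraph.Walk.cons h SimpleGraph.Walk.nil⟩ 1

theorem vertex_idem (s : V) : IsIdempotentElem (vertex A s : PathAlgebra A G) := by
  rw [IsIdempotentElem, vertex, single_mul_single_of_eq _ _ _ _ rfl]
  simp [GraphPath.concat]

theorem vertex_mul_edge {s t : V} (h : G.Adj s t) : vertex A s * edge A h = edge A h := by
  rw [vertex, edge, single_mul_single_of_eq _ _ _ _ rfl]
  simp [GraphPath.concat]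

theorem edge_mul_vertex {s t : V} (h : G.Adj s t) : edge A h * vertex A t = edge A h := by
  rw [vertex, edge, single_mul_single_of_eq _ _ _ _ rfl]
  simp [GraphPath.concat]

/-- For an edge `y = [s t]` with opposite edge `ȳ = [t s]`, the element `y ȳ = [s t s]` of the
ring `[s] AΓ [s]`, whose identity element is `[s]`. -/
def loop {s t : V} (h : G.Adj s t) :
    (vertex_idem s : IsIdempotentElem (vertex A s : PathAlgebra A G)).Corner :=
  ⟨edge A h * edge A h.symm,
    (Subsemigroup.mem_corner_iff (vertex_idem s)).2
      ⟨by rw [← mul_assoc, vertex_mul_edge], by rw [mul_assoc, edge_mul_vertex]⟩⟩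

end

end PathAlgebra

/-! ### The strict universal coefficient ring of a Coxeter system -/

/-- `C_m`, the minimal polynomial of `4 cos² (π / m)` in `ℤ[t]` (used for `m ≥ 3`). -/
def cosSqMinpoly (m : ℕ) : Polynomial ℤ := minpoly ℤ (4 * Real.cos (Real.pi / m) ^ 2)

namespace CoxeterMatrix

variable {B : Type*} (M : CoxeterMatrix B)

/-- The graph of a Coxeter system: its vertices are the (indices of the) simple reflections, and
`i ≠ j` are adjacent when `m i j ≥ 3` or `m i j = ∞`; the value `∞` is encoded as `0` in
`CoxeterMatrix`. -/
def graph : SimpleGraph B where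
  Adj i j := i ≠ j ∧ (M i j = 0 ∨ 3 ≤ M i j)
  symm := ⟨fun i j h => ⟨h.1.symm, by rw [M.symmetric j i]; exact h.2⟩⟩
  loopless := ⟨fun _ h => h.1 rfl⟩

/-- The element `C_y = C_m (y ȳ)` for the edge `y = [sᵢ sⱼ]`, `m = m i j`. The polynomial is
evaluated in the ring `[sᵢ] P [sᵢ]`, so that its constant term is a multiple of `[sᵢ]`. -/
def relator {i j : B} (h : M.graph.Adj i j) : PathAlgebra ℤ M.graph :=
  (Polynomial.aeval (PathAlgebra.loop (A := ℤ) h) (cosSqMinpoly (M i j))).1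

/-- The ideal generated by the elements `C_y`, where `y` runs over the (directed) edges `[sᵢ sⱼ]`
with `3 ≤ m i j < ∞`. -/
def strictIdeal : TwoSidedIdeal (PathAlgebra ℤ M.graph) :=
  TwoSidedIdeal.span {x | ∃ (i j : B) (h : M.graph.Adj i j), M i j ≠ 0 ∧ x = M.relator h}

end CoxeterMatrix

namespace CoxeterSystem

variable {B : Type*} {M : CoxeterMatrix B} {W : Type*} [Group W]

/-- The strict universal coefficient ring `R` of the Coxeter system `(W, S)`: the quotient of the
path algebra over `ℤ` by the ideal generated by the `C_y`. It is a possibly non-unital ring. -/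
abbrev StrictRing (_cs : CoxeterSystem M W) : Type _ := M.strictIdeal.ringCon.Quotient

/-- The image of the length zero path `[sᵢ]` in `R`. -/
def vertex (cs : CoxeterSystem M W) (i : B) : cs.StrictRing :=
  ((PathAlgebra.vertex ℤ i : PathAlgebra ℤ M.graph) : M.strictIdeal.ringCon.Quotient)

/-- The Peirce component `[sᵢ] R [sⱼ]`. -/
def peirce (cs : CoxeterSystem M W) (i j : B) : Set cs.StrictRing :=
  {x | ∃ r : cs.StrictRing, x = cs.vertex i * r * cs.vertex j}

end CoxeterSystem

end

noncomputable section

open Polynomial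

/-! ### Reduction of polynomials in a path variable -/

/-! The proof gives `[s_i]R` a normal form and then runs a leading-term argument on it. Along a
single edge of label m, let X stand for one step; backtracking paths then behave like `ℤ[X]` modulo
`C_m(X²)`, with no relation when m = ∞. A normal word is a path cut into syllables, each alternating
along one edge with a reduced length, successive syllables running along distinct unoriented edges.
The path algebra acts on the right on the free abelian group of words, and the relators act by zero
(`pathAct_relator`), so R acts too. Letting x in `[s_i]R` act on the empty word and evaluating the
result in R gives x back (`wordEval_strictAct_single_nil`). Hence `wordCoeffs` embeds `[s_i]R` in a
free abelian group; in particular `[s_i]R` is torsion-free.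

The quotient by `C_m(X²)` need not be a domain (for m = 3 it is `ℤ[X]/(X² - 1)`). However, paths
with fixed endpoints along one edge have lengths of a single parity. A nonzero reduced polynomial of
one parity does not vanish at 2cos(π/m), so products of two such polynomials stay nonzero
(`mul_modByMonic_edgePoly_ne_zero`).

Suppose xy = 0 with x and y nonzero. If a longest word of x and a longest word of y met along
different edges, their concatenation would survive in xy. So all longest words of x end, and all
longest words of y start, along one edge e (`exists_top_of_strictAct_eq_zero`). Fix a longest word
of x and one of y, with stems u₀ and v₀ left after removing the syllable along e. Let a and b be the
polynomials of coefficients of x on the extensions of u₀ along e, and of y on the words that run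
along e and then follow v₀. Comparing coefficients at words ending in v₀ shows that xb has at most
|u₀| syllables (`strictAct_apply_append`). The coefficients of xb on the extensions of u₀ form ab
modulo the relation (`collect_strictAct_altPoly`), so ab reduces to a nonzero constant γ.

Therefore (xb)(ay) = γxy = 0, where xb has fewer syllables than x and ay has no more than the bound
for y. By induction xb = 0 or ay = 0, and then γx = xba = 0 or γy = bay = 0, contradicting
torsion-freeness. -/

theorem isIntegral_four_mul_cos_sq (m : ℕ) : IsIntegral ℤ (4 * Real.cos (Real.pi / m) ^ 2) := by
  have h := Real.isIntegral_two_mul_cos_rat_mul_pi (1 / m : ℚ)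
  have e : 4 * Real.cos (Real.pi / m) ^ 2 = (2 * Real.cos (((1 / m : ℚ) : ℝ) * Real.pi)) ^ 2 := by
    rw [mul_pow]
    norm_num
    rw [inv_mul_eq_div]
  rw [e]
  exact h.pow 2

theorem cosSqMinpoly_monic (m : ℕ) : (cosSqMinpoly m).Monic :=
  minpoly.monic (isIntegral_four_mul_cos_sq m)

theorem natDegree_cosSqMinpoly_pos (m : ℕ) : 0 < (cosSqMinpoly m).natDegree :=
  minpoly.natDegree_pos (isIntegral_four_mul_cos_sq m)

/-- The polynomial `C_m(X²)`, where `X` stands for one step along an edge labelled `m`; it is `0`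
if `m = ∞` (which is encoded as `0`). -/
def edgePoly (m : ℕ) : ℤ[X] := if m = 0 then 0 else expand ℤ 2 (cosSqMinpoly m)

theorem edgePoly_zero : edgePoly 0 = 0 := if_pos rfl

theorem edgePoly_of_ne_zero {m : ℕ} (hm : m ≠ 0) : edgePoly m = expand ℤ 2 (cosSqMinpoly m) :=
  if_neg hm

theorem edgePoly_monic {m : ℕ} (hm : m ≠ 0) : (edgePoly m).Monic := by
  rw [edgePoly_of_ne_zero hm]
  exact (cosSqMinpoly_monic m).expand two_pos

theorem natDegree_edgePoly {m : ℕ} (hm : m ≠ 0) :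
    (edgePoly m).natDegree = (cosSqMinpoly m).natDegree * 2 := by
  rw [edgePoly_of_ne_zero hm, natDegree_expand]

/-- The exponents of the reduced monomials modulo `edgePoly m`. -/
def IsReducedLength (m l : ℕ) : Prop := m = 0 ∨ l < (edgePoly m).natDegree

theorem isReducedLength_zero (m : ℕ) : IsReducedLength m 0 := by
  by_cases hm : m = 0
  · exact Or.inl hm
  · refine Or.inr ?_
    rw [natDegree_edgePoly hm]
    have := natDegree_cosSqMinpoly_pos m
    omega

/-- Division by 0, which is not monic, returns the dividend; thus m = ∞ shares its formulas with the
finite labels. -/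
theorem modByMonic_edgePoly_zero (p : ℤ[X]) : p %ₘ edgePoly 0 = p := by
  rw [edgePoly_zero, modByMonic_zero]

theorem isReducedLength_of_mem_support {m l : ℕ} {p : ℤ[X]}
    (h : l ∈ (p %ₘ edgePoly m).support) : IsReducedLength m l := by
  by_cases hm : m = 0
  · exact Or.inl hm
  · have h1 : edgePoly m ≠ 1 := by
      intro h1
      have := natDegree_edgePoly hm
      rw [h1, natDegree_one] at this
      have := natDegree_cosSqMinpoly_pos m
      omega
    exact Or.inr ((le_natDegree_of_mem_supp _ h).trans_lt
      (natDegree_modByMonic_lt p (edgePoly_monic hm) h1))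

theorem modByMonic_edgePoly_eq_self {m : ℕ} {p : ℤ[X]}
    (h : ∀ l ∈ p.support, IsReducedLength m l) : p %ₘ edgePoly m = p := by
  by_cases hm : m = 0
  · rw [hm, modByMonic_edgePoly_zero]
  · rw [modByMonic_eq_self_iff (edgePoly_monic hm),
      degree_eq_natDegree (edgePoly_monic hm).ne_zero, degree_lt_iff_coeff_zero]
    intro l hl
    by_contra hc
    rcases h l (mem_support_iff.2 hc) with h | h
    · exact hm h
    · omega

theorem X_pow_modByMonic_edgePoly {m l : ℕ} (h : IsReducedLength m l) :
    (X ^ l : ℤ[X]) %ₘ edgePoly m = X ^ l := by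
  refine modByMonic_edgePoly_eq_self fun k hk => ?_
  rw [support_X_pow, Finset.mem_singleton] at hk
  rwa [hk]

theorem mul_modByMonic_edgePoly_left (m : ℕ) (p q : ℤ[X]) :
    (p %ₘ edgePoly m * q) %ₘ edgePoly m = (p * q) %ₘ edgePoly m := by
  by_cases hm : m = 0
  · simp [hm, modByMonic_edgePoly_zero]
  · refine modByMonic_eq_of_dvd_sub (edgePoly_monic hm) ?_
    rw [← sub_mul]
    exact (dvd_modByMonic_sub p _).mul_right q

/-- Substituting X² in a division by `C_m` and multiplying by `X ^ e` gives a division by `C_m(X²)`: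
as e ≤ 1, the remainder has degree at most 1 + 2(deg `C_m` - 1). Reduction therefore preserves
parity. -/
theorem X_pow_mul_expand_modByMonic {m : ℕ} (hm : m ≠ 0) {e : ℕ} (he : e < 2) (p : ℤ[X]) :
    (X ^ e * expand ℤ 2 p) %ₘ edgePoly m = X ^ e * expand ℤ 2 (p %ₘ cosSqMinpoly m) := by
  refine (div_modByMonic_unique (X ^ e * expand ℤ 2 (p /ₘ cosSqMinpoly m)) _ (edgePoly_monic hm)
    ⟨?_, ?_⟩).2
  · conv_rhs => rw [← modByMonic_add_div p (cosSqMinpoly m)]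
    rw [edgePoly_of_ne_zero hm, map_add, map_mul]
    ring
  · have h1 : cosSqMinpoly m ≠ 1 := by
      intro h1
      have := natDegree_cosSqMinpoly_pos m
      rw [h1, natDegree_one] at this
      omega
    have h2 := natDegree_modByMonic_lt p (cosSqMinpoly_monic m) h1
    refine (degree_le_natDegree).trans_lt ?_
    rw [degree_eq_natDegree (edgePoly_monic hm).ne_zero, natDegree_edgePoly hm]
    refine Nat.cast_lt.2 ((natDegree_mul_le).trans_lt ?_)
    rw [natDegree_X_pow, natDegree_expand]
    omega

theorem even_iff_of_mem_support_X_pow_mul_expand {e l : ℕ} {p : ℤ[X]}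
    (h : l ∈ (X ^ e * expand ℤ 2 p).support) : Even l ↔ Even e := by
  rw [mem_support_iff, coeff_X_pow_mul'] at h
  split_ifs at h with hel
  · rw [coeff_expand two_pos] at h
    split_ifs at h with h2
    · have := (even_iff_two_dvd.2 h2)
      rw [Nat.even_sub hel] at this
      exact this
    · exact absurd rfl h
  · exact absurd rfl h

theorem even_iff_of_mem_support_X_pow_modByMonic {m k l : ℕ}
    (h : l ∈ ((X ^ k : ℤ[X]) %ₘ edgePoly m).support) : Even l ↔ Even k := by
  by_cases hm : m = 0
  · rw [hm, modByMonic_edgePoly_zero, support_X_pow, Finset.mem_singleton] at h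
    rw [h]
  · have hk : (X ^ k : ℤ[X]) = X ^ (k % 2) * expand ℤ 2 (X ^ (k / 2)) := by
      rw [map_pow, expand_X, ← pow_mul, ← pow_add, Nat.mod_add_div]
    rw [hk, X_pow_mul_expand_modByMonic hm (Nat.mod_lt k two_pos)] at h
    rw [even_iff_of_mem_support_X_pow_mul_expand h]
    simp [Nat.even_iff]

/-- Polynomials all of whose exponents have the same parity. -/
def HasParity (p : ℤ[X]) : Prop := ∀ k ∈ p.support, ∀ l ∈ p.support, (Even k ↔ Even l)

theorem HasParity.exists_eq {p : ℤ[X]} (hp : HasParity p) (h0 : p ≠ 0) :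
    ∃ e < 2, ∃ q : ℤ[X], p = X ^ e * expand ℤ 2 q := by
  obtain ⟨k, hk⟩ := nonempty_support_iff.2 h0
  refine ⟨k % 2, Nat.mod_lt k two_pos,
    ∑ l ∈ p.support, C (p.coeff l) * X ^ (l / 2), ?_⟩
  rw [map_sum, Finset.mul_sum]
  conv_lhs => rw [p.as_sum_support_C_mul_X_pow]
  refine Finset.sum_congr rfl fun l hl => ?_
  rw [map_mul, expand_C, map_pow, expand_X, ← pow_mul]
  have : l = k % 2 + 2 * (l / 2) := by
    have := hp k hk l hl
    rw [Nat.even_iff, Nat.even_iff] at this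
    omega
  have hX : (X ^ l : ℤ[X]) = X ^ (k % 2) * X ^ (2 * (l / 2)) := by rw [← pow_add, ← this]
  rw [hX]
  ring

/-- A degree bound alone is not enough, since `C_m(X²)` may be reducible. Parity gives p = X^e q(X²)
with q reduced modulo `C_m`, so q does not vanish at 4cos²(π/m); and 2cos(π/m) > 0 because m ≥ 3. -/
theorem aeval_ne_zero_of_hasParity {m : ℕ} (hm : 3 ≤ m) {p : ℤ[X]} (hp : HasParity p)
    (h0 : p ≠ 0) (hr : ∀ l ∈ p.support, IsReducedLength m l) :
    aeval (2 * Real.cos (Real.pi / m)) p ≠ 0 := by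
  obtain ⟨e, he, q, rfl⟩ := hp.exists_eq h0
  have hm0 : m ≠ 0 := by omega
  have h2 := modByMonic_edgePoly_eq_self hr
  rw [X_pow_mul_expand_modByMonic hm0 he] at h2
  have h3 := mul_left_cancel₀ (pow_ne_zero e X_ne_zero) h2
  have h4 : q %ₘ cosSqMinpoly m = q := expand_injective two_pos h3
  have hq0 : q ≠ 0 := by rintro rfl; simp at h0
  rw [map_mul, map_pow, aeval_X, expand_aeval]
  refine mul_ne_zero (pow_ne_zero _ (mul_ne_zero two_ne_zero (ne_of_gt ?_))) ?_
  · refine Real.cos_pos_of_mem_Ioo ⟨?_, ?_⟩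
    · have : 0 < Real.pi / m := div_pos Real.pi_pos (by positivity)
      linarith [Real.pi_pos]
    · refine div_lt_div_of_pos_left Real.pi_pos two_pos ?_
      exact_mod_cast (by omega : 2 < m)
  · intro hz
    have e : (2 * Real.cos (Real.pi / m)) ^ 2 = 4 * Real.cos (Real.pi / m) ^ 2 := by ring
    rw [e, minpoly.isIntegrallyClosed_dvd_iff (isIntegral_four_mul_cos_sq m)] at hz
    rw [(modByMonic_eq_zero_iff_dvd (cosSqMinpoly_monic m)).2 hz] at h4
    exact hq0 h4.symm

theorem mul_modByMonic_edgePoly_ne_zero {m : ℕ} (hm : m = 0 ∨ 3 ≤ m) {p q : ℤ[X]}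
    (hp : HasParity p) (hq : HasParity q) (hp0 : p ≠ 0) (hq0 : q ≠ 0)
    (hpr : ∀ l ∈ p.support, IsReducedLength m l) (hqr : ∀ l ∈ q.support, IsReducedLength m l) :
    (p * q) %ₘ edgePoly m ≠ 0 := by
  rcases hm with rfl | hm
  · rw [modByMonic_edgePoly_zero]
    exact mul_ne_zero hp0 hq0
  · have hm0 : m ≠ 0 := by omega
    rw [Ne, modByMonic_eq_zero_iff_dvd (edgePoly_monic hm0)]
    rintro ⟨r, hr⟩
    have h := congrArg (aeval (2 * Real.cos (Real.pi / m))) hr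
    rw [map_mul, map_mul, edgePoly_of_ne_zero hm0, expand_aeval,
      show (2 * Real.cos (Real.pi / m)) ^ 2 = 4 * Real.cos (Real.pi / m) ^ 2 by ring,
      cosSqMinpoly, minpoly.aeval, zero_mul] at h
    exact mul_ne_zero (aeval_ne_zero_of_hasParity hm hp hp0 hpr)
      (aeval_ne_zero_of_hasParity hm hq hq0 hqr) h

/-- Reduction preserves the parity of exponents, so a constant term must come from a product of
monomials of even total degree. -/
theorem even_iff_of_zero_mem_support_mul {m : ℕ} {p q : ℤ[X]} (hp : HasParity p)
    (hq : HasParity q) (h : 0 ∈ ((p * q) %ₘ edgePoly m).support) :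
    ∀ k ∈ p.support, ∀ l ∈ q.support, (Even k ↔ Even l) := by
  have h1 : ∃ n ∈ (p * q).support, Even n := by
    by_contra! hc
    rw [mem_support_iff, (p * q).as_sum_support_C_mul_X_pow] at h
    refine h ?_
    rw [← modByMonicHom_apply, map_sum, finsetSum_coeff]
    refine Finset.sum_eq_zero fun n hn => ?_
    rw [← smul_eq_C_mul, map_smul, coeff_smul, modByMonicHom_apply]
    by_contra hz
    exact hc n hn ((even_iff_of_mem_support_X_pow_modByMonic
      (mem_support_iff.2 (right_ne_zero_of_smul hz))).1 Even.zero)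
  obtain ⟨n, hn, hev⟩ := h1
  rw [mem_support_iff, coeff_mul] at hn
  obtain ⟨⟨k', l'⟩, hkl, hne⟩ := Finset.exists_ne_zero_of_sum_ne_zero hn
  rw [Finset.HasAntidiagonal.mem_antidiagonal] at hkl
  rw [← hkl, Nat.even_add] at hev
  intro k hk l hl
  rw [hp k hk k' (mem_support_iff.2 (left_ne_zero_of_mul hne)), hev,
    hq l hl l' (mem_support_iff.2 (right_ne_zero_of_mul hne))]

/-! ### Additive extension from bases -/

/-- The additive extension of a function on monomials. -/
def polyExt {N : Type*} [AddCommGroup N] (φ : ℕ → N) : ℤ[X] →+ N :=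
  (Polynomial.lsum fun l => LinearMap.toSpanSingleton ℤ N (φ l)).toAddMonoidHom

theorem polyExt_X_pow {N : Type*} [AddCommGroup N] (φ : ℕ → N) (l : ℕ) :
    polyExt φ (X ^ l) = φ l := by
  change Polynomial.lsum _ (X ^ l) = φ l
  rw [X_pow_eq_monomial, lsum_apply, sum_monomial_index]
  · simp
  · simp

theorem map_poly_mem {N : Type*} [AddCommGroup N] (S : AddSubgroup N) (φ : ℤ[X] →+ N) {p : ℤ[X]}
    (h : ∀ l ∈ p.support, φ (X ^ l) ∈ S) : φ p ∈ S := by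
  rw [p.as_sum_support_C_mul_X_pow, map_sum]
  refine S.sum_mem fun l hl => ?_
  rw [← smul_eq_C_mul, map_zsmul]
  exact S.zsmul_mem (h l hl) _

theorem map_poly_congr {N : Type*} [AddCommGroup N] (φ ψ : ℤ[X] →+ N) {p : ℤ[X]}
    (h : ∀ l ∈ p.support, φ (X ^ l) = ψ (X ^ l)) : φ p = ψ p := by
  have := map_poly_mem ⊥ (φ - ψ) (p := p) fun l hl => by simp [h l hl]
  rwa [AddSubgroup.mem_bot, AddMonoidHom.sub_apply, sub_eq_zero] at this

/-- The additive extension of a function on the basis of a free abelian group. -/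
def freeExt {α N : Type*} [AddCommGroup N] (φ : α → N) : (α →₀ ℤ) →+ N :=
  Finsupp.liftAddHom fun w => zmultiplesHom N (φ w)

theorem freeExt_single {α N : Type*} [AddCommGroup N] (φ : α → N) (w : α) (c : ℤ) :
    freeExt φ (Finsupp.single w c) = c • φ w := by
  simp [freeExt]

theorem freeExt_single_one {α N : Type*} [AddCommGroup N] (φ : α → N) (w : α) :
    freeExt φ (Finsupp.single w 1) = φ w := by
  rw [freeExt_single, one_zsmul]

theorem map_single_eq_zsmul {α N : Type*} [AddCommGroup N] (φ : (α →₀ ℤ) →+ N) (w : α) (c : ℤ) :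
    φ (Finsupp.single w c) = c • φ (Finsupp.single w 1) := by
  rw [← map_zsmul]
  simp

theorem map_free_mem {α N : Type*} [AddCommGroup N] (S : AddSubgroup N) (φ : (α →₀ ℤ) →+ N)
    {f : α →₀ ℤ} (h : ∀ w ∈ f.support, φ (Finsupp.single w 1) ∈ S) : φ f ∈ S := by
  rw [← Finsupp.sum_single f, Finsupp.sum, map_sum]
  refine S.sum_mem fun w hw => ?_
  rw [map_single_eq_zsmul]
  exact S.zsmul_mem (h w hw) _

theorem map_free_congr {α N : Type*} [AddCommGroup N] (φ ψ : (α →₀ ℤ) →+ N) {f : α →₀ ℤ}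
    (h : ∀ w ∈ f.support, φ (Finsupp.single w 1) = ψ (Finsupp.single w 1)) : φ f = ψ f := by
  have := map_free_mem ⊥ (φ - ψ) (f := f) fun w hw => by simp [h w hw]
  rwa [AddSubgroup.mem_bot, AddMonoidHom.sub_apply, sub_eq_zero] at this

theorem free_hom_ext {α N : Type*} [AddCommGroup N] {φ ψ : (α →₀ ℤ) →+ N}
    (h : ∀ w, φ (Finsupp.single w 1) = ψ (Finsupp.single w 1)) : φ = ψ :=
  AddMonoidHom.ext fun _ => map_free_congr φ ψ fun w _ => h w

/-- The combinations of basis elements in a given set. -/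
def supportedIn {α : Type*} (s : Set α) : AddSubgroup (α →₀ ℤ) :=
  (Finsupp.supported ℤ ℤ s).toAddSubgroup

theorem mem_supportedIn {α : Type*} {s : Set α} {f : α →₀ ℤ} :
    f ∈ supportedIn s ↔ ∀ w ∈ f.support, w ∈ s := Iff.rfl

theorem single_mem_supportedIn {α : Type*} {s : Set α} {w : α} (h : w ∈ s) :
    Finsupp.single w 1 ∈ supportedIn s := by
  rw [mem_supportedIn]
  intro v hv
  have := Finsupp.support_single_subset hv
  rw [Finset.mem_singleton] at this
  rwa [this]

theorem apply_eq_zero_of_mem_supportedIn {α : Type*} {s : Set α} {f : α →₀ ℤ}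
    (h : f ∈ supportedIn s) {w : α} (hw : w ∉ s) : f w = 0 := by
  by_contra hc
  exact hw (h (Finsupp.mem_support_iff.2 hc))

/-! ### Alternating sequences of vertices -/

/-- The vertex reached after `k` steps of an alternating path `a, b, a, b, …`. -/
def altVertex {B : Type*} (a b : B) (k : ℕ) : B := if Even k then a else b

theorem altVertex_zero {B : Type*} (a b : B) : altVertex a b 0 = a := if_pos Even.zero

theorem altVertex_succ {B : Type*} (a b : B) (k : ℕ) : altVertex a b (k + 1) = altVertex b a k := by
  unfold altVertex
  by_cases h : Even k
  · rw [if_neg (by simpa using Nat.even_add_one.not.2 (not_not.2 h)), if_pos h]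
  · rw [if_pos (Nat.even_add_one.2 h), if_neg h]

theorem altVertex_congr {B : Type*} (a b : B) {k l : ℕ} (h : Even k ↔ Even l) :
    altVertex a b k = altVertex a b l := by
  unfold altVertex
  simp only [h]

theorem altVertex_altVertex {B : Type*} (a b : B) (k l : ℕ) :
    altVertex (altVertex a b k) (altVertex b a k) l = altVertex a b (k + l) := by
  unfold altVertex
  by_cases hk : Even k <;> by_cases hl : Even l <;> simp [hk, hl, Nat.even_add]

theorem mk_altVertex {B : Type*} (a b : B) (k : ℕ) :
    s(altVertex a b k, altVertex b a k) = s(a, b) := by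
  unfold altVertex
  by_cases hk : Even k <;> simp [hk, Sym2.eq_swap]

theorem even_iff_of_altVertex_eq {B : Type*} {a b : B} (h : a ≠ b) {k l : ℕ}
    (e : altVertex a b k = altVertex a b l) : Even k ↔ Even l := by
  unfold altVertex at e
  by_cases hk : Even k <;> by_cases hl : Even l
  · exact iff_of_true hk hl
  · rw [if_pos hk, if_neg hl] at e
    exact absurd e h
  · rw [if_neg hk, if_pos hl] at e
    exact absurd e.symm h
  · exact iff_of_false hk hl

/-! ### Normal words -/

/-- A syllable: an alternating path of length `len` starting with the edge `[src tgt]`. -/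
structure Syllable (B : Type*) where
  src : B
  tgt : B
  len : ℕ

/-- The unoriented edge along which a syllable runs. -/
def Syllable.edge {B : Type*} (s : Syllable B) : Sym2 B := s(s.src, s.tgt)

/-- The end of a word starting at `i`. The last syllable of a word is the head of the list. -/
def endVertex {B : Type*} (i : B) : List (Syllable B) → B
  | [] => i
  | s :: _ => altVertex s.src s.tgt s.len

/-- The word does not end with a syllable along the edge `e`. -/
def EndAvoids {B : Type*} (e : Sym2 B) (w : List (Syllable B)) : Prop :=
  ∀ s ∈ w.head?, s.edge ≠ e

/-- The word does not start with a syllable along the edge `e`. -/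
def StartAvoids {B : Type*} (e : Sym2 B) (w : List (Syllable B)) : Prop :=
  ∀ s ∈ w.getLast?, s.edge ≠ e

/-- The word `w` followed by `l` alternating steps starting with `[a b]`. -/
def extendWord {B : Type*} (a b : B) (l : ℕ) (w : List (Syllable B)) : List (Syllable B) :=
  if l = 0 then w else ⟨a, b, l⟩ :: w

theorem extendWord_zero {B : Type*} (a b : B) (w : List (Syllable B)) :
    extendWord a b 0 w = w := if_pos rfl

theorem extendWord_of_ne_zero {B : Type*} (a b : B) {l : ℕ} (hl : l ≠ 0)
    (w : List (Syllable B)) : extendWord a b l w = ⟨a, b, l⟩ :: w := if_neg hl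

theorem length_extendWord_le {B : Type*} (a b : B) (l : ℕ) (w : List (Syllable B)) :
    (extendWord a b l w).length ≤ w.length + 1 := by
  unfold extendWord
  split_ifs <;> simp

theorem le_length_extendWord {B : Type*} (a b : B) (l : ℕ) (w : List (Syllable B)) :
    w.length ≤ (extendWord a b l w).length := by
  unfold extendWord
  split_ifs <;> simp

theorem extendWord_inj {B : Type*} {a b c d : B} {k l : ℕ} {u v : List (Syllable B)}
    (e : s(a, b) = s(c, d)) (hu : EndAvoids s(a, b) u) (hv : EndAvoids s(c, d) v)
    (h : extendWord a b k u = extendWord c d l v) : k = l ∧ u = v := by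
  by_cases hk : k = 0 <;> by_cases hl : l = 0
  · subst hk hl
    exact ⟨rfl, by simpa only [extendWord_zero] using h⟩
  · subst hk
    rw [extendWord_zero, extendWord_of_ne_zero _ _ hl] at h
    subst h
    exact absurd e.symm (hu _ rfl)
  · subst hl
    rw [extendWord_zero, extendWord_of_ne_zero _ _ hk] at h
    subst h
    exact absurd e (hv _ rfl)
  · rw [extendWord_of_ne_zero _ _ hk, extendWord_of_ne_zero _ _ hl] at h
    simp only [List.cons.injEq, Syllable.mk.injEq] at h
    exact ⟨h.1.2.2, h.2⟩

/-- The free abelian group on the words. -/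
abbrev WordModule (B : Type*) : Type _ := List (Syllable B) →₀ ℤ

namespace CoxeterMatrix

variable {B : Type*} (M : CoxeterMatrix B)

/-- Normal words starting at `i`: successive reduced syllables along distinct edges. -/
def IsNormal (i : B) : List (Syllable B) → Prop
  | [] => True
  | s :: w => IsNormal i w ∧ endVertex i w = s.src ∧ M.graph.Adj s.src s.tgt ∧ s.len ≠ 0 ∧
      IsReducedLength (M s.src s.tgt) s.len ∧ EndAvoids s.edge w

/-- The word `u` is normal and can be extended along the edge `[c d]`, along which it does not
already end. -/
structure IsExtensible (i c d : B) (u : List (Syllable B)) : Prop where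
  isNormal : M.IsNormal i u
  endVertex_eq : endVertex i u = c
  adj : M.graph.Adj c d
  endAvoids : EndAvoids s(c, d) u

variable {M}

theorem IsExtensible.isNormal_extendWord {i c d : B} {u : List (Syllable B)}
    (h : M.IsExtensible i c d u) {l : ℕ} (hl : IsReducedLength (M c d) l) :
    M.IsNormal i (extendWord c d l u) := by
  by_cases h0 : l = 0
  · rw [h0, extendWord_zero]
    exact h.isNormal
  · rw [extendWord_of_ne_zero _ _ h0]
    exact ⟨h.isNormal, h.endVertex_eq, h.adj, h0, hl, h.endAvoids⟩

theorem IsExtensible.endVertex_extendWord {i c d : B} {u : List (Syllable B)}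
    (h : M.IsExtensible i c d u) (l : ℕ) :
    endVertex i (extendWord c d l u) = altVertex c d l := by
  by_cases h0 : l = 0
  · rw [h0, extendWord_zero, altVertex_zero]
    exact h.endVertex_eq
  · rw [extendWord_of_ne_zero _ _ h0]
    rfl

/-- The stem u is w without its last syllable if that syllable runs along the edge, and w itself (k
= 0) otherwise. Starting a new syllable and prolonging or reducing the last one thus become the
single operation of multiplying by X. -/
theorem IsNormal.exists_extendWord {i a b : B} {w : List (Syllable B)} (hw : M.IsNormal i w)
    (ha : endVertex i w = a) (hab : M.graph.Adj a b) :
    ∃ c d k u, M.IsExtensible i c d u ∧ IsReducedLength (M c d) k ∧ w = extendWord c d k u ∧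
      altVertex c d k = a ∧ altVertex d c k = b := by
  by_cases h : EndAvoids s(a, b) w
  · exact ⟨a, b, 0, w, ⟨hw, ha, hab, h⟩, isReducedLength_zero _, (extendWord_zero _ _ _).symm,
      altVertex_zero _ _, altVertex_zero _ _⟩
  · cases w with
    | nil => exact absurd (fun s hs => by simp at hs) h
    | cons s u =>
      obtain ⟨h1, h2, h3, h4, h5, h6⟩ := hw
      have he : s.edge = s(a, b) := by
        by_contra hc
        exact h fun t ht => by
          simp only [List.head?_cons, Option.mem_def, Option.some.injEq] at ht
          rwa [← ht]
      refine ⟨s.src, s.tgt, s.len, u, ⟨h1, h2, h3, h6⟩, h5,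
        (extendWord_of_ne_zero _ _ h4 _).symm, ha, ?_⟩
      have h7 := mk_altVertex s.src s.tgt s.len
      have h8 : altVertex s.src s.tgt s.len = a := ha
      rw [h8] at h7
      exact Sym2.congr_right.1 (h7.trans he)

/-! ### Reduction along a single edge, and the action of steps. -/

variable (M)

/-- The combination of words obtained from the word `u` by following the alternating path
`X ↦ [c d]`, after reduction modulo the relation of the edge. -/
def extendPoly (c d : B) (u : List (Syllable B)) : ℤ[X] →+ WordModule B :=
  (polyExt fun l => Finsupp.single (extendWord c d l u) 1).comp
    (modByMonicHom (edgePoly (M c d))).toAddMonoidHom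

theorem extendPoly_apply (c d : B) (u : List (Syllable B)) (p : ℤ[X]) :
    M.extendPoly c d u p =
      polyExt (fun l => Finsupp.single (extendWord c d l u) 1) (p %ₘ edgePoly (M c d)) := rfl

theorem extendPoly_X_pow {c d : B} {l : ℕ} (hl : IsReducedLength (M c d) l)
    (u : List (Syllable B)) :
    M.extendPoly c d u (X ^ l) = Finsupp.single (extendWord c d l u) 1 := by
  rw [extendPoly_apply, X_pow_modByMonic_edgePoly hl, polyExt_X_pow]

theorem map_extendPoly {N : Type*} [AddCommGroup N] {c d : B} {u : List (Syllable B)}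
    (L : WordModule B →+ N) (φ : ℤ[X] →+ N) {p : ℤ[X]}
    (h : ∀ l ∈ (p %ₘ edgePoly (M c d)).support,
      L (Finsupp.single (extendWord c d l u) 1) = φ (X ^ l)) :
    L (M.extendPoly c d u p) = φ (p %ₘ edgePoly (M c d)) := by
  rw [extendPoly_apply, ← AddMonoidHom.comp_apply]
  refine map_poly_congr _ _ fun l hl => ?_
  rw [AddMonoidHom.comp_apply, polyExt_X_pow, h l hl]

theorem extendPoly_mod_mul (c d : B) (u : List (Syllable B)) (p q : ℤ[X]) :
    M.extendPoly c d u (p %ₘ edgePoly (M c d) * q) = M.extendPoly c d u (p * q) := by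
  rw [extendPoly_apply, extendPoly_apply, mul_modByMonic_edgePoly_left]

theorem extendPoly_mem {c d : B} {u : List (Syllable B)} {p : ℤ[X]}
    (S : AddSubgroup (WordModule B))
    (h : ∀ l ∈ (p %ₘ edgePoly (M c d)).support, Finsupp.single (extendWord c d l u) 1 ∈ S) :
    M.extendPoly c d u p ∈ S := by
  rw [extendPoly_apply]
  exact map_poly_mem S _ fun l hl => by rw [polyExt_X_pow]; exact h l hl

/-! ### The action of the path algebra on words -/

open Classical in
/-- The projection onto the normal words ending at `a`. -/
def wordProj (i a : B) : (WordModule B →+ WordModule B) :=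
  freeExt fun w => if M.IsNormal i w ∧ endVertex i w = a then Finsupp.single w 1 else 0

open Classical in
/-- The action of the edge `[a b]` on a normal word ending at `a`. -/
def stepWord (a b : B) : List (Syllable B) → WordModule B
  | [] => M.extendPoly a b [] X
  | s :: u => if s.edge = s(a, b) then M.extendPoly s.src s.tgt u (X ^ (s.len + 1))
      else M.extendPoly a b (s :: u) X

open Classical in
/-- The action of the edge `[a b]`. -/
def wordStep (i a b : B) : (WordModule B →+ WordModule B) :=
  freeExt fun w => if M.IsNormal i w ∧ endVertex i w = a then M.stepWord a b w else 0

/-- The action of a walk. -/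
def walkAct (i : B) : {a b : B} → M.graph.Walk a b → (WordModule B →+ WordModule B)
  | a, _, .nil => M.wordProj i a
  | a, _, .cons (v := b) _ p => (walkAct i p).comp (M.wordStep i a b)

variable {M}

theorem wordProj_single {i a : B} {w : List (Syllable B)} (hw : M.IsNormal i w)
    (ha : endVertex i w = a) : M.wordProj i a (Finsupp.single w 1) = Finsupp.single w 1 := by
  rw [wordProj, freeExt_single_one, if_pos ⟨hw, ha⟩]

theorem wordProj_single_of_not {i a : B} {w : List (Syllable B)}
    (h : ¬ (M.IsNormal i w ∧ endVertex i w = a)) : M.wordProj i a (Finsupp.single w 1) = 0 := by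
  rw [wordProj, freeExt_single_one, if_neg h]

theorem wordStep_single_of_not {i a b : B} {w : List (Syllable B)}
    (h : ¬ (M.IsNormal i w ∧ endVertex i w = a)) : M.wordStep i a b (Finsupp.single w 1) = 0 := by
  rw [wordStep, freeExt_single_one, if_neg h]

theorem IsExtensible.wordStep_single {i c d : B} {u : List (Syllable B)}
    (h : M.IsExtensible i c d u) {k : ℕ} (hk : IsReducedLength (M c d) k) :
    M.wordStep i (altVertex c d k) (altVertex d c k) (Finsupp.single (extendWord c d k u) 1) =
      M.extendPoly c d u (X ^ (k + 1)) := by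
  rw [wordStep, freeExt_single_one,
    if_pos ⟨h.isNormal_extendWord hk, h.endVertex_extendWord k⟩]
  by_cases h0 : k = 0
  · subst h0
    rw [extendWord_zero, altVertex_zero, altVertex_zero, zero_add, pow_one]
    cases u with
    | nil => rfl
    | cons s u => exact if_neg (h.endAvoids s rfl)
  · rw [extendWord_of_ne_zero _ _ h0]
    exact if_pos (mk_altVertex c d k).symm

/-- This holds even when `X ^ k` is not reduced: all words in its reduction have run lengths of the
parity of k, hence end at the vertex where the step is defined. -/
theorem IsExtensible.wordStep_extendPoly {i c d : B} {u : List (Syllable B)}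
    (h : M.IsExtensible i c d u) (k : ℕ) :
    M.wordStep i (altVertex c d k) (altVertex d c k) (M.extendPoly c d u (X ^ k)) =
      M.extendPoly c d u (X ^ (k + 1)) := by
  rw [M.map_extendPoly _ ((M.extendPoly c d u).comp (AddMonoidHom.mulRight X)) fun l hl => ?_]
  · rw [AddMonoidHom.comp_apply, AddMonoidHom.mulRight_apply, extendPoly_mod_mul, pow_succ]
  · have he := even_iff_of_mem_support_X_pow_modByMonic hl
    rw [← altVertex_congr c d he, ← altVertex_congr d c he,
      h.wordStep_single (isReducedLength_of_mem_support hl), AddMonoidHom.comp_apply,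
      AddMonoidHom.mulRight_apply, pow_succ]

theorem IsExtensible.wordProj_extendPoly {i c d : B} {u : List (Syllable B)}
    (h : M.IsExtensible i c d u) (k : ℕ) :
    M.wordProj i (altVertex c d k) (M.extendPoly c d u (X ^ k)) =
      M.extendPoly c d u (X ^ k) := by
  rw [M.map_extendPoly _ (M.extendPoly c d u) fun l hl => ?_]
  · have := M.extendPoly_mod_mul c d u (X ^ k) 1
    rwa [mul_one, mul_one] at this
  · have hl' := isReducedLength_of_mem_support hl
    rw [wordProj_single (h.isNormal_extendWord hl'), M.extendPoly_X_pow hl']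
    rw [h.endVertex_extendWord, altVertex_congr c d (even_iff_of_mem_support_X_pow_modByMonic hl)]

theorem wordProj_comp_wordStep (i : B) {a b : B} (hab : M.graph.Adj a b) :
    (M.wordProj i b).comp (M.wordStep i a b) = M.wordStep i a b := by
  refine free_hom_ext fun w => ?_
  rw [AddMonoidHom.comp_apply]
  by_cases hw : M.IsNormal i w ∧ endVertex i w = a
  · obtain ⟨c, d, k, u, h, hk, rfl, rfl, rfl⟩ := hw.1.exists_extendWord hw.2 hab
    rw [h.wordStep_single hk, ← altVertex_succ, h.wordProj_extendPoly]
  · rw [wordStep_single_of_not hw, map_zero]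

theorem wordStep_comp_wordProj (i a b : B) :
    (M.wordStep i a b).comp (M.wordProj i a) = M.wordStep i a b := by
  refine free_hom_ext fun w => ?_
  rw [AddMonoidHom.comp_apply]
  by_cases hw : M.IsNormal i w ∧ endVertex i w = a
  · rw [wordProj_single hw.1 hw.2]
  · rw [wordProj_single_of_not hw, wordStep_single_of_not hw, map_zero]

theorem wordProj_comp_wordProj (i a : B) :
    (M.wordProj i a).comp (M.wordProj i a) = M.wordProj i a := by
  refine free_hom_ext fun w => ?_
  rw [AddMonoidHom.comp_apply]
  by_cases hw : M.IsNormal i w ∧ endVertex i w = a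
  · rw [wordProj_single hw.1 hw.2, wordProj_single hw.1 hw.2]
  · rw [wordProj_single_of_not hw, map_zero]

theorem wordProj_comp_wordProj_of_ne (i : B) {a b : B} (hab : a ≠ b) :
    (M.wordProj i b).comp (M.wordProj i a) = 0 := by
  refine free_hom_ext fun w => ?_
  rw [AddMonoidHom.comp_apply]
  by_cases hw : M.IsNormal i w ∧ endVertex i w = a
  · rw [wordProj_single hw.1 hw.2, wordProj_single_of_not fun h => hab (hw.2.symm.trans h.2)]
    rfl
  · rw [wordProj_single_of_not hw, map_zero]
    rfl

theorem walkAct_comp_wordProj (i : B) {a b : B} (p : M.graph.Walk a b) :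
    (M.walkAct i p).comp (M.wordProj i a) = M.walkAct i p := by
  cases p with
  | nil => exact wordProj_comp_wordProj i a
  | cons h p =>
    rw [walkAct, AddMonoidHom.comp_assoc, wordStep_comp_wordProj]

theorem wordProj_comp_walkAct (i : B) {a b : B} (p : M.graph.Walk a b) :
    (M.wordProj i b).comp (M.walkAct i p) = M.walkAct i p := by
  induction p with
  | nil => exact wordProj_comp_wordProj i _
  | cons h p ih => rw [walkAct, ← AddMonoidHom.comp_assoc, ih]

theorem walkAct_append (i : B) {a b c : B} (p : M.graph.Walk a b) (q : M.graph.Walk b c) :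
    M.walkAct i (p.append q) = (M.walkAct i q).comp (M.walkAct i p) := by
  induction p with
  | nil => exact (walkAct_comp_wordProj i q).symm
  | cons h p ih =>
    rw [SimpleGraph.Walk.cons_append, walkAct, ih, walkAct, AddMonoidHom.comp_assoc]

/-! ### The action of the whole path algebra. -/

variable (M)

/-- The (right) action of the path algebra on words starting at `i`. -/
def pathAct (i : B) : PathAlgebra ℤ M.graph →+ (WordModule B →+ WordModule B) :=
  freeExt (α := GraphPath M.graph) fun p => M.walkAct i p.walk

variable {M}

theorem pathAct_single (i : B) (p : GraphPath M.graph) (c : ℤ) :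
    M.pathAct i (PathAlgebra.single p c) = c • M.walkAct i p.walk :=
  freeExt_single _ p c

theorem pathAct_mul (i : B) (x y : PathAlgebra ℤ M.graph) :
    M.pathAct i (x * y) = (M.pathAct i y).comp (M.pathAct i x) := by
  induction x using PathAlgebra.induction_on with
  | zero => rw [zero_mul, map_zero, AddMonoidHom.comp_zero]
  | add f g hf hg =>
    rw [add_mul, map_add, hf, hg, map_add]
    exact (AddMonoidHom.comp_add _ _ _).symm
  | single p a =>
    induction y using PathAlgebra.induction_on with
    | zero => rw [mul_zero, map_zero, AddMonoidHom.zero_comp]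
    | add f g hf hg =>
      rw [mul_add, map_add, hf, hg, map_add]
      exact (AddMonoidHom.add_comp _ _ _).symm
    | single q b =>
      rw [pathAct_single, pathAct_single]
      have key : (b • M.walkAct i q.walk).comp (a • M.walkAct i p.walk) =
          (a * b) • (M.walkAct i q.walk).comp (M.walkAct i p.walk) := by
        refine AddMonoidHom.ext fun f => ?_
        change b • M.walkAct i q.walk (a • M.walkAct i p.walk f) =
          (a * b) • M.walkAct i q.walk (M.walkAct i p.walk f)
        rw [map_zsmul, smul_smul, mul_comm]
      refine Eq.trans ?_ key.symm
      by_cases h : p.terminus = q.origin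
      · rw [PathAlgebra.single_mul_single_of_eq p q a b h, pathAct_single]
        obtain ⟨a, b, p⟩ := p
        obtain ⟨c, d, q⟩ := q
        dsimp only at h
        subst h
        exact congrArg _ (walkAct_append i p q)
      -- For non-composable paths, the projections onto two distinct end vertices meet in the
      -- composite and kill it.
      · rw [PathAlgebra.single_mul_single_of_ne p q a b h, map_zero,
          ← wordProj_comp_walkAct i p.walk, ← walkAct_comp_wordProj i q.walk,
          AddMonoidHom.comp_assoc, ← AddMonoidHom.comp_assoc _ (M.wordProj i p.terminus),
          wordProj_comp_wordProj_of_ne i h, AddMonoidHom.zero_comp, AddMonoidHom.comp_zero,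
          smul_zero]

theorem pathAct_vertex (i a : B) :
    M.pathAct i (PathAlgebra.vertex ℤ a) = M.wordProj i a := by
  rw [PathAlgebra.vertex, pathAct_single, one_zsmul]
  rfl

theorem pathAct_edge (i : B) {a b : B} (h : M.graph.Adj a b) :
    M.pathAct i (PathAlgebra.edge ℤ h) = M.wordStep i a b := by
  rw [PathAlgebra.edge, pathAct_single, one_zsmul]
  exact wordProj_comp_wordStep i h

end CoxeterMatrix

namespace CoxeterMatrix

variable {B : Type*} (M : CoxeterMatrix B)

/-! ### Alternating elements of the path algebra -/

theorem apply_eq_of_sym2_eq {a b c d : B} (h : s(a, b) = s(c, d)) : M a b = M c d := by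
  rcases Sym2.eq_iff.1 h with ⟨rfl, rfl⟩ | ⟨rfl, rfl⟩
  · rfl
  · exact M.symmetric _ _

theorem adj_of_sym2_eq {a b c d : B} (h : s(a, b) = s(c, d)) (hab : M.graph.Adj a b) :
    M.graph.Adj c d := by
  rcases Sym2.eq_iff.1 h with ⟨rfl, rfl⟩ | ⟨rfl, rfl⟩
  · exact hab
  · exact hab.symm

open Classical in
/-- The edge `[a b]`, or `0` if there is no such edge. -/
def edgeElt (a b : B) : PathAlgebra ℤ M.graph :=
  if h : M.graph.Adj a b then PathAlgebra.edge ℤ h else 0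

/-- The alternating path `[a b a b …]` of length `l`. -/
def altPath (a b : B) : ℕ → PathAlgebra ℤ M.graph
  | 0 => PathAlgebra.vertex ℤ a
  | l + 1 => altPath a b l * M.edgeElt (altVertex a b l) (altVertex b a l)

/-- The polynomial expressions in the alternating paths `[a b a b …]`. -/
def altPoly (a b : B) : ℤ[X] →+ PathAlgebra ℤ M.graph := polyExt (M.altPath a b)

variable {M}

theorem edgeElt_of_adj {a b : B} (h : M.graph.Adj a b) :
    M.edgeElt a b = PathAlgebra.edge ℤ h := dif_pos h

theorem edgeElt_mul_vertex (a b : B) :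
    M.edgeElt a b * PathAlgebra.vertex ℤ b = M.edgeElt a b := by
  unfold edgeElt
  split_ifs with h
  · exact PathAlgebra.edge_mul_vertex h
  · exact zero_mul _

theorem altPath_mul_vertex (a b : B) (l : ℕ) :
    M.altPath a b l * PathAlgebra.vertex ℤ (altVertex a b l) = M.altPath a b l := by
  cases l with
  | zero => exact PathAlgebra.vertex_idem a
  | succ l => rw [altPath, mul_assoc, altVertex_succ, edgeElt_mul_vertex]

theorem vertex_mul_altPath (a b : B) (l : ℕ) :
    PathAlgebra.vertex ℤ a * M.altPath a b l = M.altPath a b l := by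
  induction l with
  | zero => exact PathAlgebra.vertex_idem a
  | succ l ih => rw [altPath, ← mul_assoc, ih]

theorem altPath_mul_altPath (a b : B) (k l : ℕ) :
    M.altPath a b k * M.altPath (altVertex a b k) (altVertex b a k) l =
      M.altPath a b (k + l) := by
  induction l with
  | zero => exact altPath_mul_vertex a b k
  | succ l ih =>
    rw [altPath, ← mul_assoc, ih, altVertex_altVertex, altVertex_altVertex]
    rfl

theorem altPoly_X_pow (a b : B) (l : ℕ) : M.altPoly a b (X ^ l) = M.altPath a b l :=
  polyExt_X_pow _ l

theorem altPath_mul_altPoly (a b : B) (k : ℕ) (q : ℤ[X]) :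
    M.altPath a b k * M.altPoly (altVertex a b k) (altVertex b a k) q =
      M.altPoly a b (X ^ k * q) :=
  map_poly_congr ((AddMonoidHom.mulLeft (M.altPath a b k)).comp
      (M.altPoly (altVertex a b k) (altVertex b a k)))
    ((M.altPoly a b).comp (AddMonoidHom.mulLeft (X ^ k))) fun l _ => by
      rw [AddMonoidHom.comp_apply, AddMonoidHom.comp_apply, AddMonoidHom.coe_mulLeft,
        AddMonoidHom.coe_mulLeft, ← pow_add, altPoly_X_pow, altPoly_X_pow, altPath_mul_altPath]

theorem altPoly_mul_altPoly {a b c d : B} {p q : ℤ[X]}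
    (hp : ∀ k ∈ p.support, altVertex a b k = c ∧ altVertex b a k = d) :
    M.altPoly a b p * M.altPoly c d q = M.altPoly a b (p * q) :=
  map_poly_congr ((AddMonoidHom.mulRight (M.altPoly c d q)).comp (M.altPoly a b))
    ((M.altPoly a b).comp (AddMonoidHom.mulRight q)) fun k hk => by
      rw [AddMonoidHom.comp_apply, AddMonoidHom.comp_apply, AddMonoidHom.mulRight_apply,
        AddMonoidHom.mulRight_apply, altPoly_X_pow, ← (hp k hk).1, ← (hp k hk).2,
        altPath_mul_altPoly]

theorem vertex_mul_altPoly (a b : B) (p : ℤ[X]) :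
    PathAlgebra.vertex ℤ a * M.altPoly a b p = M.altPoly a b p :=
  map_poly_congr ((AddMonoidHom.mulLeft (PathAlgebra.vertex ℤ a)).comp (M.altPoly a b))
    (M.altPoly a b) fun l _ => by
      rw [AddMonoidHom.comp_apply, altPoly_X_pow]
      exact vertex_mul_altPath a b l

theorem altPoly_mul_vertex {a b c : B} {p : ℤ[X]}
    (hp : ∀ k ∈ p.support, altVertex a b k = c) :
    M.altPoly a b p * PathAlgebra.vertex ℤ c = M.altPoly a b p :=
  map_poly_congr ((AddMonoidHom.mulRight (PathAlgebra.vertex ℤ c)).comp (M.altPoly a b))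
    (M.altPoly a b) fun l hl => by
      rw [AddMonoidHom.comp_apply, altPoly_X_pow, ← hp l hl]
      exact altPath_mul_vertex a b l

theorem altPath_two_mul {i j : B} (h : M.graph.Adj i j) (l : ℕ) :
    M.altPath i j (2 * l) = ((PathAlgebra.loop (A := ℤ) h) ^ l).1 := by
  induction l with
  | zero => rfl
  | succ l ih =>
    rw [pow_succ]
    refine Eq.trans ?_ (congrArg (· * (PathAlgebra.edge ℤ h * PathAlgebra.edge ℤ h.symm)) ih)
    change M.altPath i j (2 * l + 1 + 1) = _
    have h1 : altVertex i j (2 * l) = i := if_pos (even_two_mul l)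
    have h2 : altVertex j i (2 * l) = j := if_pos (even_two_mul l)
    rw [altPath, altPath, altVertex_succ, altVertex_succ, h1, h2, edgeElt_of_adj h,
      edgeElt_of_adj h.symm, mul_assoc]

/-- Powers of the loop in the corner ring are the alternating paths of even length; its unit is the
vertex, which accounts for the constant term. -/
theorem relator_eq_altPoly {i j : B} (h : M.graph.Adj i j) :
    M.relator h = M.altPoly i j (expand ℤ 2 (cosSqMinpoly (M i j))) := by
  let val : (PathAlgebra.vertex_idem i :
      IsIdempotentElem (PathAlgebra.vertex ℤ i : PathAlgebra ℤ M.graph)).Corner →+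
      PathAlgebra ℤ M.graph := ⟨⟨Subtype.val, rfl⟩, fun _ _ => rfl⟩
  refine map_poly_congr
    (val.comp (aeval (R := ℤ) (PathAlgebra.loop (A := ℤ) h)).toRingHom.toAddMonoidHom)
    ((M.altPoly i j).comp (expand ℤ 2).toRingHom.toAddMonoidHom) fun l _ => ?_
  change (aeval (PathAlgebra.loop (A := ℤ) h) (X ^ l)).1 = M.altPoly i j (expand ℤ 2 (X ^ l))
  rw [map_pow, map_pow, aeval_X, expand_X, ← pow_mul, altPoly_X_pow, altPath_two_mul h]

theorem IsExtensible.pathAct_altPath {i c d : B} {u : List (Syllable B)}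
    (h : M.IsExtensible i c d u) (k l : ℕ) :
    M.pathAct i (M.altPath (altVertex c d k) (altVertex d c k) l) (M.extendPoly c d u (X ^ k)) =
      M.extendPoly c d u (X ^ (k + l)) := by
  induction l with
  | zero => rw [altPath, pathAct_vertex, h.wordProj_extendPoly, add_zero]
  | succ l ih =>
    have hadj : M.graph.Adj (altVertex c d (k + l)) (altVertex d c (k + l)) :=
      M.adj_of_sym2_eq (mk_altVertex c d (k + l)).symm h.adj
    rw [altPath, pathAct_mul, AddMonoidHom.comp_apply, ih, altVertex_altVertex,
      altVertex_altVertex, edgeElt_of_adj hadj, pathAct_edge, h.wordStep_extendPoly, add_assoc]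

theorem IsExtensible.pathAct_altPoly {i c d : B} {u : List (Syllable B)}
    (h : M.IsExtensible i c d u) (k : ℕ) (p : ℤ[X]) :
    M.pathAct i (M.altPoly (altVertex c d k) (altVertex d c k) p) (M.extendPoly c d u (X ^ k)) =
      M.extendPoly c d u (X ^ k * p) := by
  refine map_poly_congr
    (((AddMonoidHom.eval (M.extendPoly c d u (X ^ k))).comp (M.pathAct i)).comp (M.altPoly _ _))
    ((M.extendPoly c d u).comp (AddMonoidHom.mulLeft (X ^ k))) fun l _ => ?_
  rw [AddMonoidHom.comp_apply, altPoly_X_pow]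
  refine (h.pathAct_altPath k l).trans ?_
  rw [pow_add]
  rfl

/-- On the words with a given stem u, the relator acts as multiplication by `C_m(X²)` modulo
`C_m(X²)`. -/
theorem pathAct_relator (i : B) {a b : B} (hab : M.graph.Adj a b) (hm : M a b ≠ 0) :
    M.pathAct i (M.relator hab) = 0 := by
  refine free_hom_ext fun w => ?_
  rw [relator_eq_altPoly, ← vertex_mul_altPoly, pathAct_mul, AddMonoidHom.comp_apply,
    pathAct_vertex]
  by_cases hw : M.IsNormal i w ∧ endVertex i w = a
  · rw [wordProj_single hw.1 hw.2]
    obtain ⟨c, d, k, u, h, hk, rfl, rfl, rfl⟩ := hw.1.exists_extendWord hw.2 hab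
    -- The label depends only on the unoriented edge; it is rewritten in `hm` as well, which serves
    -- for the monicity.
    rw [← M.extendPoly_X_pow hk, h.pathAct_altPoly,
      M.apply_eq_of_sym2_eq (mk_altVertex c d k)] at *
    rw [← edgePoly_of_ne_zero hm, extendPoly_apply, mul_self_modByMonic (edgePoly_monic hm)]
    simp
  · rw [wordProj_single_of_not hw, map_zero]
    rfl

/-! ### The action of the strict universal coefficient ring -/

variable (M)

/-- The strict universal coefficient ring attached to a Coxeter matrix. -/
abbrev StrictQuotient : Type _ := M.strictIdeal.ringCon.Quotient

/-- The projection of the path algebra to the strict universal coefficient ring. -/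
def toStrict : PathAlgebra ℤ M.graph →ₙ+* M.StrictQuotient where
  toFun x := (x : M.strictIdeal.ringCon.Quotient)
  map_mul' _ _ := rfl
  map_zero' := rfl
  map_add' _ _ := rfl

variable {M}

theorem toStrict_surjective : Function.Surjective M.toStrict := fun x =>
  Quotient.inductionOn' x fun a => ⟨a, rfl⟩

theorem toStrict_eq_zero_of_mem {x : PathAlgebra ℤ M.graph} (h : x ∈ M.strictIdeal) :
    M.toStrict x = 0 :=
  (RingCon.eq _).2 ((TwoSidedIdeal.mem_iff _ _).1 h)

theorem pathAct_eq_of_rel (i : B) {x y : PathAlgebra ℤ M.graph}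
    (h : M.strictIdeal.ringCon x y) : M.pathAct i x = M.pathAct i y := by
  let I : TwoSidedIdeal (PathAlgebra ℤ M.graph) := TwoSidedIdeal.mk'
    {x | M.pathAct i x = 0} (map_zero _)
    (fun {x y} hx hy => by
      change M.pathAct i (x + y) = 0
      rw [map_add, show M.pathAct i x = 0 from hx, show M.pathAct i y = 0 from hy, add_zero])
    (fun {x} hx => by
      change M.pathAct i (-x) = 0
      rw [map_neg, show M.pathAct i x = 0 from hx, neg_zero])
    (fun {x y} hy => by
      change M.pathAct i (x * y) = 0
      rw [pathAct_mul, show M.pathAct i y = 0 from hy, AddMonoidHom.zero_comp])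
    (fun {x y} hx => by
      change M.pathAct i (x * y) = 0
      rw [pathAct_mul, show M.pathAct i x = 0 from hx, AddMonoidHom.comp_zero])
  have hI : M.strictIdeal ≤ I := TwoSidedIdeal.span_le.2 <| by
    rintro _ ⟨a, b, hab, hm, rfl⟩
    exact (TwoSidedIdeal.mem_mk' _ _ _ _ _ _ _).2 (pathAct_relator i hab hm)
  have h1 : x - y ∈ I := hI ((TwoSidedIdeal.rel_iff _ x y).1 h)
  have h2 : x - y ∈ {x | M.pathAct i x = 0} := (TwoSidedIdeal.mem_mk' _ _ _ _ _ _ _).1 h1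
  rwa [Set.mem_ofPred_eq, map_sub, sub_eq_zero] at h2

variable (M)

/-- The (right) action of the strict universal coefficient ring on words starting at `i`. -/
def strictAct (i : B) : M.StrictQuotient →+ (WordModule B →+ WordModule B) where
  toFun x := Quotient.liftOn' x (M.pathAct i) fun _ _ h => pathAct_eq_of_rel i h
  map_zero' := map_zero (M.pathAct i)
  map_add' x y := Quotient.inductionOn₂' x y fun a b => map_add (M.pathAct i) a b

variable {M}

theorem strictAct_toStrict (i : B) (x : PathAlgebra ℤ M.graph) :
    M.strictAct i (M.toStrict x) = M.pathAct i x := rfl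

theorem strictAct_mul (i : B) (x y : M.StrictQuotient) :
    M.strictAct i (x * y) = (M.strictAct i y).comp (M.strictAct i x) :=
  Quotient.inductionOn₂' x y fun a b => pathAct_mul i a b

theorem toStrict_altPoly_mod {a b : B} (hab : M.graph.Adj a b) (p : ℤ[X]) :
    M.toStrict (M.altPoly a b (p %ₘ edgePoly (M a b))) = M.toStrict (M.altPoly a b p) := by
  by_cases hm : M a b = 0
  · rw [hm, modByMonic_edgePoly_zero]
  · have h : M.toStrict (M.altPoly a b (edgePoly (M a b))) = 0 := by
      rw [edgePoly_of_ne_zero hm, ← relator_eq_altPoly hab]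
      exact toStrict_eq_zero_of_mem (TwoSidedIdeal.subset_span ⟨a, b, hab, hm, rfl⟩)
    conv_rhs => rw [← modByMonic_add_div p (edgePoly (M a b)), map_add, map_add]
    -- Every exponent of `C_m(X²)` is even, so its paths return to a and a multiple of it factors
    -- through the relator.
    rw [← altPoly_mul_altPoly (c := a) (d := b), map_mul, h, zero_mul, add_zero]
    intro k hk
    have hk' : Even k := by
      rw [edgePoly_of_ne_zero hm, ← one_mul (expand ℤ 2 _), ← pow_zero X] at hk
      exact (even_iff_of_mem_support_X_pow_mul_expand hk).2 Even.zero
    exact ⟨if_pos hk', if_pos hk'⟩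

/-! ### The elements of the ring given by words -/

variable (M)

/-- The element given by a word starting at `i`. -/
def wordElt (i : B) : List (Syllable B) → M.StrictQuotient
  | [] => M.toStrict (PathAlgebra.vertex ℤ i)
  | s :: w => wordElt i w * M.toStrict (M.altPath s.src s.tgt s.len)

/-- The additive extension of `wordElt`. -/
def wordEval (i : B) : WordModule B →+ M.StrictQuotient := freeExt (M.wordElt i)

variable {M}

theorem wordEval_single (i : B) (w : List (Syllable B)) :
    M.wordEval i (Finsupp.single w 1) = M.wordElt i w := freeExt_single_one _ w

theorem IsNormal.wordElt_mul_vertex {i : B} {w : List (Syllable B)} (hw : M.IsNormal i w) :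
    M.wordElt i w * M.toStrict (PathAlgebra.vertex ℤ (endVertex i w)) = M.wordElt i w := by
  cases w with
  | nil => rw [wordElt, ← map_mul]; exact congrArg _ (PathAlgebra.vertex_idem i)
  | cons s w =>
    rw [wordElt, mul_assoc, ← map_mul]
    exact congrArg _ (congrArg _ (altPath_mul_vertex _ _ _))

theorem IsExtensible.wordElt_extendWord {i c d : B} {u : List (Syllable B)}
    (h : M.IsExtensible i c d u) (l : ℕ) :
    M.wordElt i (extendWord c d l u) = M.wordElt i u * M.toStrict (M.altPath c d l) := by
  by_cases hl : l = 0
  · subst hl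
    rw [extendWord_zero, altPath, ← h.endVertex_eq, h.isNormal.wordElt_mul_vertex]
  · rw [extendWord_of_ne_zero _ _ hl, wordElt]

theorem IsExtensible.wordEval_extendPoly {i c d : B} {u : List (Syllable B)}
    (h : M.IsExtensible i c d u) (p : ℤ[X]) :
    M.wordEval i (M.extendPoly c d u p) = M.wordElt i u * M.toStrict (M.altPoly c d p) := by
  rw [← toStrict_altPoly_mod h.adj]
  refine M.map_extendPoly (M.wordEval i)
    ((AddMonoidHom.mulLeft (M.wordElt i u)).comp
      ((M.toStrict : PathAlgebra ℤ M.graph →+ M.StrictQuotient).comp (M.altPoly c d))) fun l _ => ?_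
  rw [wordEval_single, h.wordElt_extendWord, AddMonoidHom.comp_apply, AddMonoidHom.comp_apply,
    altPoly_X_pow]
  rfl

/-- The normal words from `i` to `j`. -/
def normalWords (M : CoxeterMatrix B) (i j : B) : Set (List (Syllable B)) :=
  {w | M.IsNormal i w ∧ endVertex i w = j}

theorem wordEval_wordStep {i a b : B} (hab : M.graph.Adj a b) {f : WordModule B}
    (hf : f ∈ supportedIn (M.normalWords i a)) :
    M.wordEval i (M.wordStep i a b f) =
      M.wordEval i f * M.toStrict (PathAlgebra.edge ℤ hab) := by
  refine map_free_congr ((M.wordEval i).comp (M.wordStep i a b))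
    ((AddMonoidHom.mulRight (M.toStrict (PathAlgebra.edge ℤ hab))).comp (M.wordEval i))
    fun w hw => ?_
  obtain ⟨hw, ha⟩ := hf hw
  obtain ⟨c, d, k, u, h, hk, rfl, rfl, rfl⟩ := hw.exists_extendWord ha hab
  rw [AddMonoidHom.comp_apply, h.wordStep_single hk, h.wordEval_extendPoly, altPoly_X_pow,
    AddMonoidHom.comp_apply, wordEval_single, h.wordElt_extendWord, altPath, edgeElt_of_adj hab,
    map_mul, ← mul_assoc]
  rfl

theorem pathAct_vertex_mem (i a : B) (f : WordModule B) :
    M.wordProj i a f ∈ supportedIn (M.normalWords i a) := by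
  refine map_free_mem _ _ fun w _ => ?_
  by_cases hw : M.IsNormal i w ∧ endVertex i w = a
  · rw [wordProj_single hw.1 hw.2]
    exact single_mem_supportedIn hw
  · rw [wordProj_single_of_not hw]
    exact zero_mem _

theorem wordProj_of_mem {i a : B} {f : WordModule B}
    (hf : f ∈ supportedIn (M.normalWords i a)) : M.wordProj i a f = f :=
  map_free_congr _ (AddMonoidHom.id _) fun _ hw => wordProj_single (hf hw).1 (hf hw).2

theorem wordEval_walkAct {i a b : B} (p : M.graph.Walk a b) {f : WordModule B}
    (hf : f ∈ supportedIn (M.normalWords i a)) :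
    M.wordEval i (M.walkAct i p f) =
      M.wordEval i f * M.toStrict (PathAlgebra.single ⟨a, b, p⟩ 1) := by
  induction p generalizing f with
  | nil =>
    rename_i a
    rw [walkAct, wordProj_of_mem hf]
    refine map_free_congr (M.wordEval i)
      ((AddMonoidHom.mulRight (M.toStrict (PathAlgebra.vertex ℤ a))).comp (M.wordEval i))
      fun w hw => ?_
    obtain ⟨hw, rfl⟩ := hf hw
    rw [AddMonoidHom.comp_apply, wordEval_single]
    exact hw.wordElt_mul_vertex.symm
  | cons h p ih =>
    rw [walkAct, AddMonoidHom.comp_apply, ih, wordEval_wordStep h hf, mul_assoc, ← map_mul]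
    · rw [PathAlgebra.edge, PathAlgebra.single_mul_single_of_eq _ _ _ _ rfl]
      simp [GraphPath.concat]
    · rw [← wordProj_comp_wordStep i h]
      exact pathAct_vertex_mem _ _ _

/-- By this, x is determined by its action on the empty word; no separate rewriting argument is
needed. -/
theorem wordEval_strictAct_single_nil {i : B} {x : M.StrictQuotient}
    (hx : M.toStrict (PathAlgebra.vertex ℤ i) * x = x) :
    M.wordEval i (M.strictAct i x (Finsupp.single [] 1)) = x := by
  obtain ⟨y, rfl⟩ := toStrict_surjective x
  conv_rhs => rw [← hx]
  have hnil : (Finsupp.single [] 1 : WordModule B) ∈ supportedIn (M.normalWords i i) :=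
    single_mem_supportedIn ⟨trivial, rfl⟩
  rw [strictAct_toStrict]
  clear hx
  refine map_free_congr (α := GraphPath M.graph)
    ((M.wordEval i).comp ((AddMonoidHom.eval (Finsupp.single [] 1)).comp (M.pathAct i)))
    ((AddMonoidHom.mulLeft (M.toStrict (PathAlgebra.vertex ℤ i))).comp
      (M.toStrict : PathAlgebra ℤ M.graph →+ M.StrictQuotient)) (f := y) fun p _ => ?_
  change M.wordEval i (M.pathAct i (PathAlgebra.single p 1) (Finsupp.single [] 1)) =
    M.toStrict (PathAlgebra.vertex ℤ i) * M.toStrict (PathAlgebra.single p 1)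
  rw [pathAct_single, one_zsmul]
  obtain ⟨a, b, p⟩ := p
  by_cases ha : a = i
  · subst ha
    rw [wordEval_walkAct p hnil, wordEval_single]
    rfl
  · rw [← walkAct_comp_wordProj, AddMonoidHom.comp_apply,
      wordProj_single_of_not fun h => ha h.2.symm, map_zero, map_zero, ← map_mul,
      PathAlgebra.vertex, PathAlgebra.single_mul_single_of_ne _ _ _ _ (Ne.symm ha), map_zero]

end CoxeterMatrix

/-! ### First and last edges of words. -/

theorem endAvoids_of_append {B : Type*} {e : Sym2 B} {v w : List (Syllable B)}
    (h : EndAvoids e (v ++ w)) : EndAvoids e v := by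
  cases v with
  | nil => exact fun s hs => by simp at hs
  | cons t v => exact h

theorem exists_eq_append_of_not_startAvoids {B : Type*} {e : Sym2 B} {q : List (Syllable B)}
    (h : ¬ StartAvoids e q) : ∃ v s, q = v ++ [s] ∧ s.edge = e := by
  rcases List.eq_nil_or_concat q with rfl | ⟨v, s, rfl⟩
  · exact absurd (fun s hs => by simp at hs) h
  · rw [List.concat_eq_append] at h ⊢
    refine ⟨v, s, rfl, ?_⟩
    by_contra hc
    exact h fun t ht => by
      rw [List.getLast?_concat, Option.mem_some_iff] at ht
      rwa [← ht]

theorem startAvoids_append_singleton {B : Type*} {e : Sym2 B} {v : List (Syllable B)}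
    {s : Syllable B} : StartAvoids e (v ++ [s]) ↔ s.edge ≠ e := by
  simp [StartAvoids]

theorem exists_eq_cons_of_not_endAvoids {B : Type*} {e : Sym2 B} {q : List (Syllable B)}
    (h : ¬ EndAvoids e q) : ∃ v s, q = s :: v ∧ s.edge = e := by
  cases q with
  | nil => exact absurd (fun s hs => by simp at hs) h
  | cons s v =>
    refine ⟨v, s, rfl, ?_⟩
    by_contra hc
    exact h fun t ht => by
      rw [List.head?_cons, Option.mem_some_iff] at ht
      rwa [← ht]

theorem append_extendWord_inj {B : Type*} {a b : B} {k l : ℕ} {u v : List (Syllable B)}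
    (hu : StartAvoids s(a, b) u) (hv : StartAvoids s(a, b) v)
    (h : u ++ extendWord a b k [] = v ++ extendWord a b l []) : k = l ∧ u = v := by
  by_cases hk : k = 0 <;> by_cases hl : l = 0
  · subst hk hl
    exact ⟨rfl, by simpa only [extendWord_zero, List.append_nil] using h⟩
  · subst hk
    rw [extendWord_zero, extendWord_of_ne_zero _ _ hl, List.append_nil] at h
    subst h
    exact absurd rfl (startAvoids_append_singleton.1 hu)
  · subst hl
    rw [extendWord_zero, extendWord_of_ne_zero _ _ hk, List.append_nil] at h
    subst h
    exact absurd rfl (startAvoids_append_singleton.1 hv)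
  · rw [extendWord_of_ne_zero _ _ hk, extendWord_of_ne_zero _ _ hl] at h
    obtain ⟨h1, h2⟩ := List.append_inj' h rfl
    simp only [List.cons.injEq, Syllable.mk.injEq] at h2
    exact ⟨h2.1.2.2, h1⟩

/-- The words of length at most `n`. -/
def shortWords (B : Type*) (n : ℕ) : Set (List (Syllable B)) := {w | w.length ≤ n}

theorem supportedIn_mono {α : Type*} {s t : Set α} (h : s ⊆ t) {f : α →₀ ℤ}
    (hf : f ∈ supportedIn s) : f ∈ supportedIn t := fun _ hw => h (hf hw)

theorem shortWords_mono {B : Type*} {m n : ℕ} (h : m ≤ n) : shortWords B m ⊆ shortWords B n :=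
  fun _ hw => le_trans hw h

namespace CoxeterMatrix

variable {B : Type*} {M : CoxeterMatrix B}

/-! ### Splitting off the first syllable -/

/-- The first syllable sits at the right end of the list; once it is removed, the remaining word
starts at the vertex where it stopped. -/
theorem IsNormal.of_append_extendWord {a b : B} {l : ℕ} {v : List (Syllable B)}
    (h : M.IsNormal a (v ++ extendWord a b l [])) :
    IsReducedLength (M a b) l ∧ M.IsNormal (altVertex a b l) v ∧
      (l ≠ 0 → StartAvoids s(a, b) v) ∧
      endVertex a (v ++ extendWord a b l []) = endVertex (altVertex a b l) v := by
  induction v with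
  | nil =>
    rw [List.nil_append] at h ⊢
    by_cases hl : l = 0
    · subst hl
      refine ⟨isReducedLength_zero _, trivial, fun h => absurd rfl h, ?_⟩
      rw [extendWord_zero, altVertex_zero]
    · rw [extendWord_of_ne_zero _ _ hl] at h ⊢
      exact ⟨h.2.2.2.2.1, trivial, fun _ s hs => by simp at hs, rfl⟩
  | cons t v ih =>
    obtain ⟨h1, h2, h3, h4, h5, h6⟩ := h
    obtain ⟨i1, i2, i3, i4⟩ := ih h1
    refine ⟨i1, ⟨i2, i4.symm.trans h2, h3, h4, h5, endAvoids_of_append h6⟩, fun hl => ?_, rfl⟩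
    rcases List.eq_nil_or_concat v with rfl | ⟨v', s, rfl⟩
    · intro s hs
      rw [List.getLast?_singleton, Option.mem_some_iff] at hs
      subst hs
      replace h6 : EndAvoids t.edge (extendWord a b l []) := h6
      rw [extendWord_of_ne_zero _ _ hl] at h6
      exact Ne.symm (h6 _ rfl)
    · have := i3 hl
      rw [List.concat_eq_append] at this ⊢
      rw [← List.cons_append]
      rw [startAvoids_append_singleton] at this ⊢
      exact this

theorem IsNormal.src_eq_of_append_singleton {j : B} {v : List (Syllable B)} {s : Syllable B}
    (h : M.IsNormal j (v ++ [s])) : s.src = j ∧ s.len ≠ 0 ∧ M.graph.Adj s.src s.tgt := by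
  induction v with
  | nil => exact ⟨h.2.1.symm, h.2.2.2.1, h.2.2.1⟩
  | cons t v ih => exact ih h.1

theorem IsNormal.exists_append_extendWord {j j' : B} {q : List (Syllable B)}
    (hq : M.IsNormal j q) :
    ∃ v l, q = v ++ extendWord j j' l [] ∧ StartAvoids s(j, j') v := by
  by_cases h : StartAvoids s(j, j') q
  · exact ⟨q, 0, by rw [extendWord_zero, List.append_nil], h⟩
  · obtain ⟨v, ⟨a, b, l⟩, rfl, hs⟩ := exists_eq_append_of_not_startAvoids h
    obtain ⟨rfl, hl, -⟩ := hq.src_eq_of_append_singleton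
    obtain rfl : b = j' := Sym2.congr_right.1 hs
    have hl : l ≠ 0 := hl
    refine ⟨v, l, by rw [extendWord_of_ne_zero _ _ hl], ?_⟩
    rw [← extendWord_of_ne_zero _ _ hl] at hq
    exact hq.of_append_extendWord.2.2.1 hl

theorem IsNormal.eq_of_endVertex_eq {a b : B} {v : List (Syllable B)} (ha : M.IsNormal a v)
    (hb : M.IsNormal b v) (h : endVertex a v = endVertex b v) : a = b := by
  induction v with
  | nil => exact h
  | cons s v ih => exact ih ha.1 hb.1 (ha.2.1.trans hb.2.1.symm)

theorem wordElt_append_extendWord (a b : B) (l : ℕ) (v : List (Syllable B)) :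
    M.wordElt a (v ++ extendWord a b l []) =
      M.toStrict (M.altPath a b l) * M.wordElt (altVertex a b l) v := by
  induction v with
  | nil =>
    rw [List.nil_append, wordElt, ← map_mul, altPath_mul_vertex]
    by_cases hl : l = 0
    · subst hl
      rfl
    · rw [extendWord_of_ne_zero _ _ hl, wordElt, wordElt, ← map_mul, vertex_mul_altPath]
  | cons t v ih => rw [List.cons_append, wordElt, ih, wordElt, mul_assoc]

/-! ### The action of words on words -/

theorem strictAct_mem_normalWords (i : B) {c : B} {x : M.StrictQuotient}
    (hx : x * M.toStrict (PathAlgebra.vertex ℤ c) = x) (f : WordModule B) :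
    M.strictAct i x f ∈ supportedIn (M.normalWords i c) := by
  rw [← hx, strictAct_mul, AddMonoidHom.comp_apply, strictAct_toStrict, pathAct_vertex]
  exact pathAct_vertex_mem _ _ _

/-- No reduction happens at a junction between distinct edges. Since lists run backwards, `q ++ w`
is w followed by q. -/
theorem strictAct_wordElt_of_endAvoids {i j : B} {w q : List (Syllable B)}
    (hw : M.IsNormal i w) (hj : endVertex i w = j) (hq : M.IsNormal j q)
    (h : ∀ s ∈ q.getLast?, EndAvoids s.edge w) :
    M.IsNormal i (q ++ w) ∧ endVertex i (q ++ w) = endVertex j q ∧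
      M.strictAct i (M.wordElt j q) (Finsupp.single w 1) = Finsupp.single (q ++ w) 1 := by
  induction q with
  | nil =>
    refine ⟨hw, hj, ?_⟩
    rw [wordElt, strictAct_toStrict, pathAct_vertex, wordProj_single hw hj]
    rfl
  | cons s q ih =>
    obtain ⟨h1, h2, h3, h4, h5, h6⟩ := hq
    have h' : ∀ t ∈ q.getLast?, EndAvoids t.edge w := by
      rcases List.eq_nil_or_concat q with rfl | ⟨v, t, rfl⟩
      · exact fun t ht => by simp at ht
      · intro r hr
        rw [List.concat_eq_append] at h hr
        rw [← List.cons_append, List.getLast?_concat] at h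
        rw [List.getLast?_concat] at hr
        exact h r hr
    obtain ⟨i1, i2, i3⟩ := ih h1 h'
    have hav : EndAvoids s.edge (q ++ w) := by
      cases q with
      | nil => exact h s rfl
      | cons t q => exact h6
    have hext : M.IsExtensible i s.src s.tgt (q ++ w) := ⟨i1, i2.trans h2, h3, hav⟩
    refine ⟨⟨i1, i2.trans h2, h3, h4, h5, hav⟩, rfl, ?_⟩
    rw [wordElt, strictAct_mul, AddMonoidHom.comp_apply, i3, strictAct_toStrict]
    have := hext.pathAct_altPath 0 s.len
    rw [altVertex_zero, altVertex_zero, zero_add, M.extendPoly_X_pow (isReducedLength_zero _),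
      M.extendPoly_X_pow h5, extendWord_zero, extendWord_of_ne_zero _ _ h4] at this
    exact this

/-! ### Bounds on the number of syllables under the action. -/

theorem strictAct_altPoly_mem (S : AddSubgroup (WordModule B)) {i a b : B}
    (hab : M.graph.Adj a b) (p : ℤ[X]) {f : WordModule B}
    (h : ∀ c d k u, M.IsExtensible i c d u → s(c, d) = s(a, b) → extendWord c d k u ∈ f.support →
      ∀ l, Finsupp.single (extendWord c d l u) 1 ∈ S) :
    M.strictAct i (M.toStrict (M.altPoly a b p)) f ∈ S := by
  refine map_free_mem S _ fun w hw => ?_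
  rw [strictAct_toStrict]
  by_cases hn : M.IsNormal i w ∧ endVertex i w = a
  · obtain ⟨c, d, k, u, hu, hk, rfl, rfl, rfl⟩ := hn.1.exists_extendWord hn.2 hab
    rw [← M.extendPoly_X_pow hk, hu.pathAct_altPoly]
    exact M.extendPoly_mem S fun l _ => h c d k u hu (mk_altVertex c d k).symm hw l
  · rw [← vertex_mul_altPoly, pathAct_mul, AddMonoidHom.comp_apply, pathAct_vertex,
      wordProj_single_of_not hn, map_zero]
    exact zero_mem S

theorem strictAct_altPoly_mem_shortWords {i a b : B} (hab : M.graph.Adj a b) (p : ℤ[X]) {n : ℕ}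
    {f : WordModule B} (hf : f ∈ supportedIn (shortWords B n)) :
    M.strictAct i (M.toStrict (M.altPoly a b p)) f ∈ supportedIn (shortWords B (n + 1)) := by
  refine strictAct_altPoly_mem _ hab p fun c d k u _ _ hw l => single_mem_supportedIn ?_
  have h1 : (extendWord c d k u).length ≤ n := hf hw
  have h2 := le_length_extendWord c d k u
  have h3 := length_extendWord_le c d l u
  change (extendWord c d l u).length ≤ n + 1
  omega

theorem strictAct_wordElt_mem_shortWords {i j : B} {q : List (Syllable B)} (hq : M.IsNormal j q)
    {n : ℕ} {f : WordModule B} (hf : f ∈ supportedIn (shortWords B n)) :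
    M.strictAct i (M.wordElt j q) f ∈ supportedIn (shortWords B (n + q.length)) := by
  induction q with
  | nil =>
    rw [wordElt, strictAct_toStrict, pathAct_vertex]
    refine map_free_mem _ _ fun w hw => ?_
    by_cases hn : M.IsNormal i w ∧ endVertex i w = j
    · rw [wordProj_single hn.1 hn.2]
      exact single_mem_supportedIn (hf hw)
    · rw [wordProj_single_of_not hn]
      exact zero_mem _
  | cons s q ih =>
    rw [wordElt, strictAct_mul, AddMonoidHom.comp_apply, ← altPoly_X_pow]
    exact strictAct_altPoly_mem_shortWords hq.2.2.1 _ (ih hq.1)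

/-- The words with at most `N` syllables, and those with `N + 1` syllables that end along `e`. -/
def shortWordsAlong (e : Sym2 B) (N : ℕ) : Set (List (Syllable B)) :=
  {w | w.length ≤ N ∨ w.length ≤ N + 1 ∧ ¬ EndAvoids e w}

theorem shortWordsAlong_subset (e : Sym2 B) (N : ℕ) :
    shortWordsAlong e N ⊆ shortWords B (N + 1) := by
  rintro w (h | h)
  · exact Nat.le_succ_of_le h
  · exact h.1

theorem extendWord_mem_shortWordsAlong {c d : B} {e : Sym2 B} (he : s(c, d) = e) {N : ℕ}
    {u : List (Syllable B)} (hu : u.length ≤ N) (l : ℕ) :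
    extendWord c d l u ∈ shortWordsAlong e N := by
  by_cases hl : l = 0
  · rw [hl, extendWord_zero]
    exact Or.inl hu
  · rw [extendWord_of_ne_zero _ _ hl]
    exact Or.inr ⟨Nat.succ_le_succ hu, fun h => h _ rfl he⟩

theorem length_le_of_extendWord_mem_shortWordsAlong {c d : B} {e : Sym2 B} (he : s(c, d) = e)
    {N k : ℕ} {u : List (Syllable B)} (hu : EndAvoids s(c, d) u)
    (h : extendWord c d k u ∈ shortWordsAlong e N) : u.length ≤ N := by
  by_cases hk : k = 0
  · rw [hk, extendWord_zero] at h
    rcases h with h | h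
    · exact h
    · rw [he] at hu
      exact absurd hu h.2
  · rw [extendWord_of_ne_zero _ _ hk] at h
    rcases h with h | h
    · exact (Nat.le_succ _).trans h
    · exact Nat.le_of_succ_le_succ h.1

/-- Acting along e only creates, changes or deletes a final run along e, and a run is created only
on a word not ending along e, which here has at most N syllables. -/
theorem strictAct_altPoly_mem_shortWordsAlong {i a b : B} (hab : M.graph.Adj a b) (p : ℤ[X])
    {N : ℕ} {f : WordModule B} (hf : f ∈ supportedIn (shortWordsAlong s(a, b) N)) :
    M.strictAct i (M.toStrict (M.altPoly a b p)) f ∈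
      supportedIn (shortWordsAlong s(a, b) N) :=
  strictAct_altPoly_mem _ hab p fun _ _ _ _ hu he hw l => single_mem_supportedIn
    (extendWord_mem_shortWordsAlong he
      (length_le_of_extendWord_mem_shortWordsAlong he hu.endAvoids (hf hw)) l)

/-- If the end of `w` and the start of `q` run along the same edge, then `w q` is short. -/
theorem strictAct_wordElt_of_not_endAvoids {i j : B} {w q : List (Syllable B)}
    (hq : M.IsNormal j q) (h : ¬ ∀ s ∈ q.getLast?, EndAvoids s.edge w) :
    M.strictAct i (M.wordElt j q) (Finsupp.single w 1) ∈
      supportedIn (shortWords B (w.length + q.length - 1)) := by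
  push Not at h
  obtain ⟨s, hs, hsw⟩ := h
  obtain ⟨v, ⟨a, b, l⟩, rfl, rfl⟩ : ∃ v t, q = v ++ [t] ∧ t = s := by
    rcases List.eq_nil_or_concat q with rfl | ⟨v, t, rfl⟩
    · simp at hs
    · rw [List.concat_eq_append, List.getLast?_concat, Option.mem_some_iff] at hs
      exact ⟨v, t, List.concat_eq_append, hs⟩
  obtain ⟨rfl, hl, hadj⟩ := hq.src_eq_of_append_singleton
  have hl : l ≠ 0 := hl
  have hadj : M.graph.Adj a b := hadj
  rw [← extendWord_of_ne_zero _ _ hl] at hq ⊢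
  obtain ⟨h1, h2, -, -⟩ := hq.of_append_extendWord
  obtain ⟨u, t, rfl, -⟩ := exists_eq_cons_of_not_endAvoids hsw
  rw [wordElt_append_extendWord, strictAct_mul, AddMonoidHom.comp_apply, ← altPoly_X_pow]
  -- The run of length l merges with the last syllable of `t :: u`, so it costs no syllable; this is
  -- the saving of 1.
  have h3 : (Finsupp.single (t :: u) 1 : WordModule B) ∈
      supportedIn (shortWordsAlong s(a, b) u.length) :=
    single_mem_supportedIn (Or.inr ⟨le_rfl, hsw⟩)
  have h4 := strictAct_wordElt_mem_shortWords (i := i) h2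
    (supportedIn_mono (shortWordsAlong_subset _ _)
      (strictAct_altPoly_mem_shortWordsAlong (i := i) hadj (X ^ l) h3))
  refine supportedIn_mono (shortWords_mono ?_) h4
  rw [extendWord_of_ne_zero _ _ hl]
  simp

end CoxeterMatrix

/-! ### Collecting coefficients into a polynomial -/

open Classical in
/-- The polynomial whose coefficients are those of the elements `ρ 0, ρ 1, …`. -/
def collect {α : Type*} (ρ : ℕ → α) : (α →₀ ℤ) →+ ℤ[X] :=
  freeExt fun w => if h : ∃ k, ρ k = w then X ^ h.choose else 0

theorem collect_single {α : Type*} {ρ : ℕ → α} (hρ : Function.Injective ρ) (k : ℕ) :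
    collect ρ (Finsupp.single (ρ k) 1) = X ^ k := by
  have h : ∃ l, ρ l = ρ k := ⟨k, rfl⟩
  rw [collect, freeExt_single_one, dif_pos h, hρ h.choose_spec]

theorem collect_single_of_forall_ne {α : Type*} {ρ : ℕ → α} {w : α} (h : ∀ k, ρ k ≠ w) :
    collect ρ (Finsupp.single w 1) = 0 := by
  rw [collect, freeExt_single_one, dif_neg (not_exists.2 h)]

theorem coeff_collect {α : Type*} {ρ : ℕ → α} (hρ : Function.Injective ρ) (f : α →₀ ℤ) (k : ℕ) :
    (collect ρ f).coeff k = f (ρ k) := by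
  refine map_free_congr ((lcoeff ℤ k).toAddMonoidHom.comp (collect ρ))
    (Finsupp.applyAddHom (ρ k)) fun w _ => ?_
  change (collect ρ (Finsupp.single w 1)).coeff k = Finsupp.single w 1 (ρ k)
  by_cases h : ∃ l, ρ l = w
  · obtain ⟨l, rfl⟩ := h
    rw [collect_single hρ, coeff_X_pow]
    by_cases hkl : k = l
    · rw [if_pos hkl, hkl, Finsupp.single_eq_same]
    · rw [if_neg hkl, Finsupp.single_eq_of_ne fun h => hkl (hρ h)]
  · rw [collect_single_of_forall_ne (not_exists.1 h), coeff_zero,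
      Finsupp.single_eq_of_ne fun e => h ⟨k, e⟩]

namespace CoxeterMatrix

variable {B : Type*} {M : CoxeterMatrix B}

/-! ### Action along an edge as polynomial multiplication. -/

theorem IsExtensible.injective_extendWord {i c d : B} {u : List (Syllable B)}
    (h : M.IsExtensible i c d u) : Function.Injective fun k => extendWord c d k u :=
  fun _ _ e => (extendWord_inj rfl h.endAvoids h.endAvoids e).1

theorem injective_append_extendWord {a b : B} {v : List (Syllable B)}
    (hv : StartAvoids s(a, b) v) : Function.Injective fun k => v ++ extendWord a b k [] :=
  fun _ _ e => (append_extendWord_inj hv hv e).1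

/-- Extensions of distinct stems along one edge never coincide, so only v = u contributes; there the
action is multiplication modulo `edgePoly`. -/
theorem collect_extendPoly {i c d c' d' : B} {u v : List (Syllable B)}
    (hu : M.IsExtensible i c d u) (hv : M.IsExtensible i c' d' v) (e : s(c', d') = s(c, d))
    (k : ℕ) (p : ℤ[X]) :
    collect (fun k => extendWord c d k u) (M.extendPoly c' d' v (X ^ k * p)) =
      (collect (fun k => extendWord c d k u) (Finsupp.single (extendWord c' d' k v) 1) * p) %ₘ
        edgePoly (M c d) := by
  by_cases h : u = v
  · subst h
    obtain rfl : c' = c := hv.endVertex_eq.symm.trans hu.endVertex_eq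
    obtain rfl : d' = d := Sym2.congr_right.1 e
    rw [collect_single hu.injective_extendWord,
      M.map_extendPoly _ (AddMonoidHom.id ℤ[X]) fun l _ =>
        collect_single hu.injective_extendWord l]
    rfl
  · have h0 : ∀ l, collect (fun k => extendWord c d k u)
        (Finsupp.single (extendWord c' d' l v) 1) = 0 := fun l =>
      collect_single_of_forall_ne fun k hk =>
        h (extendWord_inj e.symm hu.endAvoids hv.endAvoids hk).2
    rw [h0, zero_mul, zero_modByMonic]
    have := M.map_extendPoly (u := v) (c := c') (d := d') (p := X ^ k * p)
      (collect (fun k => extendWord c d k u)) 0 fun l _ => h0 l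
    exact this

theorem collect_strictAct_altPoly {i j j' c d : B} {u : List (Syllable B)}
    (hu : M.IsExtensible i c d u) (e : s(c, d) = s(j, j')) (p : ℤ[X]) {f : WordModule B}
    (hf : f ∈ supportedIn (M.normalWords i j)) :
    collect (fun k => extendWord c d k u) (M.strictAct i (M.toStrict (M.altPoly j j' p)) f) =
      (collect (fun k => extendWord c d k u) f * p) %ₘ edgePoly (M c d) := by
  refine map_free_congr ((collect (fun k => extendWord c d k u)).comp
    (M.strictAct i (M.toStrict (M.altPoly j j' p))))
    (((modByMonicHom (edgePoly (M c d))).toAddMonoidHom.comp (AddMonoidHom.mulRight p)).comp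
      (collect fun k => extendWord c d k u)) fun w hw => ?_
  obtain ⟨hn, hj⟩ := hf hw
  obtain ⟨c', d', k, v, hv, hk, rfl, rfl, rfl⟩ :=
    hn.exists_extendWord hj (M.adj_of_sym2_eq e hu.adj)
  refine Eq.trans ?_ (collect_extendPoly hu hv (e.trans (mk_altVertex c' d' k)).symm k p)
  rw [AddMonoidHom.comp_apply, strictAct_toStrict, ← M.extendPoly_X_pow hk, hv.pathAct_altPoly]

/-! ### Leading coefficients of products -/

/-- Length N + K + 1 is reached only from words of h with N + 1 syllables. These end along e, which
v does not start with, so v is appended without reduction. -/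
theorem apply_eq_of_top {i c : B} {e : Sym2 B} {N K : ℕ} {v v₀ w : List (Syllable B)}
    {h : WordModule B} (hc : h ∈ supportedIn (M.normalWords i c))
    (hN : h ∈ supportedIn (shortWordsAlong e N)) (hv : M.IsNormal c v) (hve : StartAvoids e v)
    (hvK : v.length ≤ K) (hv₀ : v₀.length = K) (hw : w.length = N + 1) :
    M.strictAct i (M.wordElt c v) h (v₀ ++ w) =
      h w * Finsupp.single v 1 v₀ := by
  refine map_free_congr ((Finsupp.applyAddHom (v₀ ++ w)).comp (M.strictAct i (M.wordElt c v)))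
    ((AddMonoidHom.mulRight (Finsupp.single v 1 v₀)).comp (Finsupp.applyAddHom w))
    fun p hp => ?_
  change M.strictAct i (M.wordElt c v) (Finsupp.single p 1) (v₀ ++ w) =
    Finsupp.single p 1 w * Finsupp.single v 1 v₀
  by_cases hpN : p.length ≤ N
  · have h1 := strictAct_wordElt_mem_shortWords (i := i) hv
      (single_mem_supportedIn (s := shortWords B N) hpN)
    rw [apply_eq_zero_of_mem_supportedIn h1, Finsupp.single_eq_of_ne, zero_mul]
    · rintro rfl
      omega
    · intro h2
      have h3 : (v₀ ++ w).length ≤ N + v.length := h2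
      rw [List.length_append] at h3
      omega
  · obtain ⟨hp1, hp2⟩ : p.length ≤ N + 1 ∧ ¬ EndAvoids e p := (hN hp).resolve_left hpN
    obtain ⟨u, t, rfl, ht⟩ := exists_eq_cons_of_not_endAvoids hp2
    obtain ⟨h1, h2⟩ := hc hp
    have h3 : ∀ s ∈ v.getLast?, EndAvoids s.edge (t :: u) := by
      intro s hs r hr
      rw [List.head?_cons, Option.mem_some_iff] at hr
      rw [← hr, ht]
      exact (hve s hs).symm
    rw [(strictAct_wordElt_of_endAvoids h1 h2 hv h3).2.2]
    by_cases h4 : v = v₀ ∧ t :: u = w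
    · obtain ⟨rfl, rfl⟩ := h4
      simp
    · rw [Finsupp.single_eq_of_ne]
      · by_cases h5 : v = v₀
        · rw [Finsupp.single_eq_of_ne fun h6 => h4 ⟨h5, h6.symm⟩, zero_mul]
        · rw [Finsupp.single_eq_of_ne (Ne.symm h5), mul_zero]
      · intro h5
        obtain ⟨h6, h7⟩ := List.append_inj' h5 (by omega)
        exact h4 ⟨h6.symm, h7.symm⟩

/-- The element `x` of `[j] R` in terms of normal words. -/
def wordCoeffs (j : B) (x : M.StrictQuotient) : WordModule B :=
  M.strictAct j x (Finsupp.single [] 1)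

theorem wordEval_wordCoeffs {j : B} {x : M.StrictQuotient}
    (hx : M.toStrict (PathAlgebra.vertex ℤ j) * x = x) : M.wordEval j (wordCoeffs j x) = x :=
  wordEval_strictAct_single_nil hx

theorem wordCoeffs_mul (j : B) (x y : M.StrictQuotient) :
    wordCoeffs j (x * y) = M.strictAct j y (wordCoeffs j x) := by
  rw [wordCoeffs, strictAct_mul]
  rfl

theorem strictAct_congr {N : Type*} [AddCommGroup N] {i j : B} {x : M.StrictQuotient}
    (hx : M.toStrict (PathAlgebra.vertex ℤ j) * x = x) (f : WordModule B)
    (φ : WordModule B →+ N) (ψ : WordModule B →+ N)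
    (h : ∀ q ∈ (wordCoeffs j x).support,
      φ (M.strictAct i (M.wordElt j q) f) = ψ (Finsupp.single q 1)) :
    φ (M.strictAct i x f) = ψ (wordCoeffs j x) := by
  conv_lhs => rw [← wordEval_wordCoeffs hx]
  refine map_free_congr
    (φ.comp (((AddMonoidHom.eval f).comp (M.strictAct i)).comp (M.wordEval j))) ψ fun q hq => ?_
  rw [← h q hq, ← wordEval_single]
  rfl

theorem length_le_of_append_extendWord {a b : B} {K l : ℕ} {v q : List (Syllable B)}
    (hv : StartAvoids s(a, b) v) (hq : q = v ++ extendWord a b l [])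
    (h : q.length ≤ K ∨ q.length ≤ K + 1 ∧ ¬ StartAvoids s(a, b) q) : v.length ≤ K := by
  by_cases hl : l = 0
  · rw [hl, extendWord_zero, List.append_nil] at hq
    subst hq
    exact h.resolve_right fun h => h.2 hv
  · rw [extendWord_of_ne_zero _ _ hl] at hq
    have : q.length = v.length + 1 := by rw [hq]; simp
    rcases h with h | h
    · omega
    · have := h.1
      omega

/-- Each word of x is a run along the edge followed by some v. Its run keeps f inside
`shortWordsAlong`, so only v = v₀ reaches the target word, and summing over the runs before v₀ gives
the collected polynomial. -/
theorem strictAct_apply_append {i j j' : B} {N K : ℕ} {v₀ w : List (Syllable B)}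
    {f : WordModule B} {x : M.StrictQuotient} (hjj' : M.graph.Adj j j')
    (hx : M.toStrict (PathAlgebra.vertex ℤ j) * x = x)
    (hxn : ∀ q ∈ (wordCoeffs j x).support, M.IsNormal j q)
    (hxK : ∀ q ∈ (wordCoeffs j x).support,
      q.length ≤ K ∨ q.length ≤ K + 1 ∧ ¬ StartAvoids s(j, j') q)
    (hf : f ∈ supportedIn (shortWordsAlong s(j, j') N)) (hv₀e : StartAvoids s(j, j') v₀)
    (hv₀ : v₀.length = K) (hw : w.length = N + 1) :
    M.strictAct i x f (v₀ ++ w) =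
      M.strictAct i (M.toStrict (M.altPoly j j'
        (collect (fun l => v₀ ++ extendWord j j' l []) (wordCoeffs j x)))) f w := by
  refine strictAct_congr hx f (Finsupp.applyAddHom (v₀ ++ w)) ((Finsupp.applyAddHom w).comp
    ((AddMonoidHom.eval f).comp ((M.strictAct i).comp
      ((M.toStrict : PathAlgebra ℤ M.graph →+ M.StrictQuotient).comp ((M.altPoly j j').comp
        (collect fun l => v₀ ++ extendWord j j' l [])))))) fun q hq => ?_
  change M.strictAct i (M.wordElt j q) f (v₀ ++ w) =
    M.strictAct i (M.toStrict (M.altPoly j j'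
      (collect (fun l => v₀ ++ extendWord j j' l []) (Finsupp.single q 1)))) f w
  have hqn := hxn q hq
  have hqK := hxK q hq
  obtain ⟨v, l, hqv, hv⟩ := hqn.exists_append_extendWord (j' := j')
  have hvK := length_le_of_append_extendWord hv hqv hqK
  subst hqv
  have h1 : M.strictAct i (M.toStrict (M.altPath j j' l)) f ∈
      supportedIn (shortWordsAlong s(j, j') N) := by
    rw [← altPoly_X_pow]
    exact strictAct_altPoly_mem_shortWordsAlong hjj' _ hf
  rw [wordElt_append_extendWord, strictAct_mul, AddMonoidHom.comp_apply,
    apply_eq_of_top (strictAct_mem_normalWords i (by rw [← map_mul, altPath_mul_vertex]) f) h1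
      hqn.of_append_extendWord.2.1 hv hvK hv₀ hw]
  by_cases h : v = v₀
  · subst h
    rw [collect_single (injective_append_extendWord hv), altPoly_X_pow, Finsupp.single_eq_same,
      mul_one]
  · rw [collect_single_of_forall_ne fun k hk => h (append_extendWord_inj hv₀e hv hk).2.symm,
      Finsupp.single_eq_of_ne (Ne.symm h), mul_zero, map_zero, map_zero, map_zero]
    rfl

/-- Only pairs of longest words that join without reduction reach length n + m, and such a
concatenation splits uniquely. -/
theorem strictAct_apply_append_of_endAvoids {i j : B} {n m : ℕ} {q w : List (Syllable B)}
    {f : WordModule B} {x : M.StrictQuotient}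
    (hx : M.toStrict (PathAlgebra.vertex ℤ j) * x = x)
    (hxn : ∀ q ∈ (wordCoeffs j x).support, M.IsNormal j q)
    (hxm : wordCoeffs j x ∈ supportedIn (shortWords B m))
    (hfn : f ∈ supportedIn (M.normalWords i j)) (hf : f ∈ supportedIn (shortWords B n))
    (hw : w.length = n) (hq : q.length = m) (hqw : ∀ s ∈ q.getLast?, EndAvoids s.edge w) :
    M.strictAct i x f (q ++ w) = f w * wordCoeffs j x q := by
  refine strictAct_congr hx f (Finsupp.applyAddHom (q ++ w))
    ((AddMonoidHom.mulLeft (f w)).comp (Finsupp.applyAddHom q)) fun r hr => ?_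
  refine map_free_congr ((Finsupp.applyAddHom (q ++ w)).comp (M.strictAct i (M.wordElt j r)))
    ((AddMonoidHom.mulRight (Finsupp.single r 1 q)).comp (Finsupp.applyAddHom w))
    fun p hp => ?_
  change M.strictAct i (M.wordElt j r) (Finsupp.single p 1) (q ++ w) =
    Finsupp.single p 1 w * Finsupp.single r 1 q
  have hrm : r.length ≤ m := hxm hr
  have hpn : p.length ≤ n := hf hp
  have hlen : (q ++ w).length = m + n := by rw [List.length_append, hq, hw]
  have hzero : ¬ (p = w ∧ r = q) →
      (Finsupp.single p 1 w * Finsupp.single r 1 q : ℤ) = 0 := by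
    intro h
    by_cases h1 : p = w
    · rw [Finsupp.single_eq_of_ne fun h2 => h ⟨h1, h2.symm⟩, mul_zero]
    · rw [Finsupp.single_eq_of_ne (Ne.symm h1), zero_mul]
  by_cases hj : ∀ s ∈ r.getLast?, EndAvoids s.edge p
  · rw [(strictAct_wordElt_of_endAvoids (hfn hp).1 (hfn hp).2 (hxn r hr) hj).2.2]
    by_cases h : p = w ∧ r = q
    · obtain ⟨rfl, rfl⟩ := h
      simp
    · rw [hzero h, Finsupp.single_eq_of_ne]
      intro h1
      have h2 := congrArg List.length h1
      rw [hlen, List.length_append] at h2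
      obtain ⟨h3, h4⟩ := List.append_inj' h1 (by omega)
      exact h ⟨h4.symm, h3.symm⟩
  · rw [hzero, apply_eq_zero_of_mem_supportedIn (strictAct_wordElt_of_not_endAvoids (hxn r hr) hj)]
    · intro h1
      have h2 : (q ++ w).length ≤ p.length + r.length - 1 := h1
      have h3 : p ≠ [] := by
        rintro rfl
        exact hj fun s _ t ht => by simp at ht
      have h4 := List.length_pos_iff.2 h3
      omega
    · rintro ⟨rfl, rfl⟩
      exact hj hqw

/-! ### The ring is nearly a domain -/

theorem wordCoeffs_ne_zero {i : B} {x : M.StrictQuotient}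
    (hx : M.toStrict (PathAlgebra.vertex ℤ i) * x = x) (h : x ≠ 0) : wordCoeffs i x ≠ 0 := by
  intro h0
  rw [← wordEval_wordCoeffs hx, h0, map_zero] at h
  exact h rfl

theorem zsmul_ne_zero_of_vertex_mul {i : B} {x : M.StrictQuotient}
    (hx : M.toStrict (PathAlgebra.vertex ℤ i) * x = x) (h : x ≠ 0) {c : ℤ} (hc : c ≠ 0) :
    c • x ≠ 0 := by
  intro h0
  have h1 : c • wordCoeffs i x = 0 := by
    have h2 : wordCoeffs i (c • x) = c • wordCoeffs i x := by
      rw [wordCoeffs, map_zsmul]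
      rfl
    rw [← h2, h0, wordCoeffs, map_zero]
    rfl
  exact (smul_ne_zero hc (wordCoeffs_ne_zero hx h)) h1

theorem exists_top {f : WordModule B} (hf : f ≠ 0) :
    ∃ w ∈ f.support, f ∈ supportedIn (shortWords B w.length) := by
  obtain ⟨w, hw, h⟩ := f.support.exists_max_image List.length (Finsupp.support_nonempty_iff.2 hf)
  exact ⟨w, hw, fun v hv => h v hv⟩

theorem graph_adj_iff {a b : B} : M.graph.Adj a b ↔ a ≠ b ∧ (M a b = 0 ∨ 3 ≤ M a b) := Iff.rfl

/-- Two longest words meeting along distinct edges would give a nonzero coefficient. The pair (w, q)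
thus shares an edge; replacing w or q by any other longest word shows that it has the same edge. -/
theorem exists_top_of_strictAct_eq_zero {i j k : B} {f : WordModule B} {x : M.StrictQuotient}
    (hx : M.toStrict (PathAlgebra.vertex ℤ j) * x = x)
    (hxk : x * M.toStrict (PathAlgebra.vertex ℤ k) = x)
    (hfn : f ∈ supportedIn (M.normalWords i j))
    {w q : List (Syllable B)} (hw : w ∈ f.support) (hq : q ∈ (wordCoeffs j x).support)
    (hf : f ∈ supportedIn (shortWords B w.length))
    (hxm : wordCoeffs j x ∈ supportedIn (shortWords B q.length))
    (h0 : M.strictAct i x f = 0) :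
    ∃ c d j' k₀ u₀ v₀ l₀, M.IsExtensible i c d u₀ ∧ s(c, d) = s(j, j') ∧ k₀ ≠ 0 ∧ l₀ ≠ 0 ∧
      w = extendWord c d k₀ u₀ ∧ q = v₀ ++ extendWord j j' l₀ [] ∧
      f ∈ supportedIn (shortWordsAlong s(j, j') u₀.length) ∧
      ∀ q ∈ (wordCoeffs j x).support,
        q.length ≤ v₀.length ∨ q.length ≤ v₀.length + 1 ∧ ¬ StartAvoids s(j, j') q := by
  have hxn : ∀ q ∈ (wordCoeffs j x).support, M.IsNormal j q := fun q hq =>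
    (strictAct_mem_normalWords j hxk _ hq).1
  have key : ∀ w' ∈ f.support, ∀ q' ∈ (wordCoeffs j x).support, w'.length = w.length →
      q'.length = q.length → ¬ ∀ s ∈ q'.getLast?, EndAvoids s.edge w' := by
    intro w' hw' q' hq' h1 h2 h3
    have h4 := strictAct_apply_append_of_endAvoids hx hxn hxm hfn hf h1 h2 h3
    rw [h0] at h4
    exact mul_ne_zero (Finsupp.mem_support_iff.1 hw') (Finsupp.mem_support_iff.1 hq') h4.symm
  have h1 := key w hw q hq rfl rfl
  push Not at h1
  obtain ⟨s, hs, hsw⟩ := h1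
  obtain ⟨v₀, ⟨a, j', l₀⟩, rfl, rfl⟩ : ∃ v t, q = v ++ [t] ∧ t = s := by
    rcases List.eq_nil_or_concat q with rfl | ⟨v, t, rfl⟩
    · simp at hs
    · rw [List.concat_eq_append, List.getLast?_concat, Option.mem_some_iff] at hs
      exact ⟨v, t, List.concat_eq_append, hs⟩
  obtain ⟨rfl, hl, hadj⟩ := (hxn _ hq).src_eq_of_append_singleton
  have hl : l₀ ≠ 0 := hl
  obtain ⟨u₀, ⟨c, d, k₀⟩, rfl, ht⟩ := exists_eq_cons_of_not_endAvoids hsw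
  obtain ⟨hn1, hn2, hn3, hk₀, -, hn6⟩ := (hfn hw).1
  have hk₀ : k₀ ≠ 0 := hk₀
  refine ⟨c, d, j', k₀, u₀, v₀, l₀, ⟨hn1, hn2, hn3, hn6⟩, ht, hk₀, hl,
    (extendWord_of_ne_zero _ _ hk₀ _).symm, by rw [extendWord_of_ne_zero _ _ hl],
    fun p hp => ?_, fun r hr => ?_⟩
  · have hpl : p.length ≤ u₀.length + 1 := hf hp
    rcases Nat.le_or_eq_of_le_succ hpl with h | h
    · exact Or.inl h
    · refine Or.inr ⟨hpl, fun h2 => key p hp _ hq h rfl fun s hs => ?_⟩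
      rw [List.getLast?_concat, Option.mem_some_iff] at hs
      subst hs
      exact h2
  · have hrl : r.length ≤ (v₀ ++ [(⟨a, j', l₀⟩ : Syllable B)]).length := hxm hr
    have hvl : (v₀ ++ [(⟨a, j', l₀⟩ : Syllable B)]).length = v₀.length + 1 := by simp
    rw [hvl] at hrl
    rcases Nat.le_or_eq_of_le_succ hrl with h | h
    · exact Or.inl h
    · refine Or.inr ⟨hrl, fun h2 => key _ hw r hr rfl (h.trans hvl.symm) fun s hs t ht' => ?_⟩
      rw [List.head?_cons, Option.mem_some_iff] at ht'
      rw [← ht', ht]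
      exact (h2 s hs).symm

/-- A run put in front merges with the first syllable of those words of x that have K + 1 syllables,
so the bound K + 1 is kept. -/
theorem wordCoeffs_altPoly_mul_mem {c d j j' : B} {K : ℕ} {x : M.StrictQuotient}
    (hcd : M.graph.Adj c d) (e : s(c, d) = s(j, j')) (p : ℤ[X])
    (hx : M.toStrict (PathAlgebra.vertex ℤ j) * x = x)
    (hxn : ∀ q ∈ (wordCoeffs j x).support, M.IsNormal j q)
    (hxK : ∀ q ∈ (wordCoeffs j x).support,
      q.length ≤ K ∨ q.length ≤ K + 1 ∧ ¬ StartAvoids s(j, j') q) :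
    wordCoeffs c (M.toStrict (M.altPoly c d p) * x) ∈ supportedIn (shortWords B (K + 1)) := by
  rw [wordCoeffs_mul]
  have hnil : (Finsupp.single [] 1 : WordModule B) ∈ supportedIn (shortWordsAlong s(c, d) 0) :=
    single_mem_supportedIn (Or.inl le_rfl)
  have h1 : wordCoeffs c (M.toStrict (M.altPoly c d p)) ∈
      supportedIn (shortWordsAlong s(j, j') 0) := by
    rw [← e]
    exact strictAct_altPoly_mem_shortWordsAlong hcd p hnil
  conv in M.strictAct c x => rw [← wordEval_wordCoeffs hx]
  refine map_free_mem _ (((AddMonoidHom.eval (wordCoeffs c (M.toStrict (M.altPoly c d p)))).comp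
    (M.strictAct c)).comp (M.wordEval j)) fun q hq => ?_
  change M.strictAct c (M.wordEval j (Finsupp.single q 1)) _ ∈ _
  have hqn := hxn q hq
  have hqK := hxK q hq
  obtain ⟨v, l, hqv, hv⟩ := hqn.exists_append_extendWord (j' := j')
  have hvK := length_le_of_append_extendWord hv hqv hqK
  subst hqv
  rw [wordEval_single, wordElt_append_extendWord, strictAct_mul, AddMonoidHom.comp_apply,
    ← altPoly_X_pow]
  refine supportedIn_mono (shortWords_mono ?_) (strictAct_wordElt_mem_shortWords
    hqn.of_append_extendWord.2.1 (supportedIn_mono (shortWordsAlong_subset _ _)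
      (strictAct_altPoly_mem_shortWordsAlong (M.adj_of_sym2_eq e hcd) (X ^ l) h1)))
  omega

theorem hasParity_of_altVertex {a b c : B} (hab : a ≠ b) {p : ℤ[X]}
    (h : ∀ k ∈ p.support, altVertex a b k = c) : HasParity p := fun k hk l hl =>
  even_iff_of_altVertex_eq hab ((h k hk).trans (h l hl).symm)

/-- The induction is on a strict bound for the total syllable count, with vertices and elements left
free since the step changes them. -/
theorem eq_zero_or_eq_zero_of_mul_eq_zero_of_length_lt (N : ℕ) : ∀ {i j k : B} {n m : ℕ}
    {x y : M.StrictQuotient}, n + m < N → M.toStrict (PathAlgebra.vertex ℤ i) * x = x →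
    x * M.toStrict (PathAlgebra.vertex ℤ j) = x → M.toStrict (PathAlgebra.vertex ℤ j) * y = y →
    y * M.toStrict (PathAlgebra.vertex ℤ k) = y →
    wordCoeffs i x ∈ supportedIn (shortWords B n) →
    wordCoeffs j y ∈ supportedIn (shortWords B m) → x * y = 0 → x = 0 ∨ y = 0 := by
  induction N with
  | zero => exact fun h => absurd h (Nat.not_lt_zero _)
  | succ N ih =>
    intro i j k n m x y hN hix hxj hjy hyk hn hm hxy
    by_contra! hne
    obtain ⟨hx0, hy0⟩ := hne
    obtain ⟨w, hw, hwtop⟩ := exists_top (wordCoeffs_ne_zero hix hx0)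
    obtain ⟨q, hq, hqtop⟩ := exists_top (wordCoeffs_ne_zero hjy hy0)
    have hwn : w.length ≤ n := hn hw
    have hqm : q.length ≤ m := hm hq
    have hfn : wordCoeffs i x ∈ supportedIn (M.normalWords i j) :=
      strictAct_mem_normalWords i hxj _
    have hgn : wordCoeffs j y ∈ supportedIn (M.normalWords j k) :=
      strictAct_mem_normalWords j hyk _
    have h0 : M.strictAct i y (wordCoeffs i x) = 0 := by
      rw [← wordCoeffs_mul, hxy, wordCoeffs, map_zero]
      rfl
    obtain ⟨c, d, j', k₀, u₀, v₀, l₀, hu, he, hk₀, hl₀, rfl, rfl, hfe, hge⟩ :=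
      exists_top_of_strictAct_eq_zero hjy hyk hfn hw hq hwtop hqtop h0
    have hjj' : M.graph.Adj j j' := M.adj_of_sym2_eq he hu.adj
    have hv₀ : StartAvoids s(j, j') v₀ := (hgn hq).1.of_append_extendWord.2.2.1 hl₀
    have hρ := hu.injective_extendWord
    have hσ := injective_append_extendWord hv₀
    rw [extendWord_of_ne_zero _ _ hk₀, List.length_cons] at hwn
    rw [extendWord_of_ne_zero _ _ hl₀, List.length_append, List.length_singleton] at hqm
    set a := collect (fun k => extendWord c d k u₀) (wordCoeffs i x) with ha
    set b := collect (fun l => v₀ ++ extendWord j j' l []) (wordCoeffs j y) with hb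
    have ha_mem : ∀ k ∈ a.support, extendWord c d k u₀ ∈ (wordCoeffs i x).support := by
      intro k hk
      rw [mem_support_iff, ha, coeff_collect hρ] at hk
      exact Finsupp.mem_support_iff.2 hk
    have hb_mem : ∀ l ∈ b.support, v₀ ++ extendWord j j' l [] ∈ (wordCoeffs j y).support := by
      intro l hl
      rw [mem_support_iff, hb, coeff_collect hσ] at hl
      exact Finsupp.mem_support_iff.2 hl
    have ha_supp : k₀ ∈ a.support := by
      rw [mem_support_iff, ha, coeff_collect hρ]
      exact Finsupp.mem_support_iff.1 hw
    have hb_supp : l₀ ∈ b.support := by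
      rw [mem_support_iff, hb, coeff_collect hσ]
      exact Finsupp.mem_support_iff.1 hq
    have ha_vert : ∀ k ∈ a.support, altVertex c d k = j := fun k hk =>
      (hu.endVertex_extendWord k).symm.trans (hfn (ha_mem k hk)).2
    have hb_vert : ∀ l ∈ b.support, altVertex j j' l = altVertex j j' l₀ := by
      intro l hl
      obtain ⟨h1, h2⟩ := hgn (hb_mem l hl)
      obtain ⟨h3, h4⟩ := hgn hq
      obtain ⟨-, h5, -, h6⟩ := h1.of_append_extendWord
      obtain ⟨-, h7, -, h8⟩ := h3.of_append_extendWord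
      exact h5.eq_of_endVertex_eq h7 (by rw [← h6, ← h8, h2, h4])
    have ha_par := hasParity_of_altVertex hu.adj.ne ha_vert
    have hb_par := hasParity_of_altVertex hjj'.ne hb_vert
    have hM : M c d = M j j' := M.apply_eq_of_sym2_eq he
    have ha_red : ∀ k ∈ a.support, IsReducedLength (M c d) k := by
      intro k hk
      by_cases hk0 : k = 0
      · rw [hk0]
        exact isReducedLength_zero _
      · have h1 := (hfn (ha_mem k hk)).1
        rw [extendWord_of_ne_zero _ _ hk0] at h1
        exact h1.2.2.2.2.1
    have hb_red : ∀ l ∈ b.support, IsReducedLength (M c d) l := by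
      intro l hl
      rw [hM]
      exact (hgn (hb_mem l hl)).1.of_append_extendWord.1
    have hab : (a * b) %ₘ edgePoly (M c d) ≠ 0 :=
      mul_modByMonic_edgePoly_ne_zero (graph_adj_iff.1 hu.adj).2 ha_par hb_par
        (nonempty_support_iff.1 ⟨k₀, ha_supp⟩) (nonempty_support_iff.1 ⟨l₀, hb_supp⟩) ha_red hb_red
    have hcoll := collect_strictAct_altPoly hu he b hfn
    -- A word with |u₀| + 1 syllables in xb would reappear, followed by v₀ and with the same
    -- coefficient, in xy = 0.
    have hshort : wordCoeffs i (x * M.toStrict (M.altPoly j j' b)) ∈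
        supportedIn (shortWords B u₀.length) := by
      rw [wordCoeffs_mul]
      intro z hz
      have h1 : z ∈ shortWordsAlong s(j, j') u₀.length :=
        strictAct_altPoly_mem_shortWordsAlong hjj' b hfe hz
      rcases h1 with h1 | h1
      · exact h1
      · by_contra h2
        have h3 : z.length = u₀.length + 1 := le_antisymm h1.1 (Nat.succ_le_of_lt (not_le.1 h2))
        have h4 := strictAct_apply_append (i := i) hjj' hjy (fun q hq => (hgn hq).1) hge hfe hv₀ rfl h3
        rw [h0] at h4
        exact Finsupp.mem_support_iff.1 hz h4.symm
    -- The coefficient of X^l is that of xb at u₀ extended by l steps, a word that is too long as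
    -- soon as l ≠ 0.
    have hconst : (a * b) %ₘ edgePoly (M c d) =
        C (((a * b) %ₘ edgePoly (M c d)).coeff 0) := by
      refine Polynomial.ext fun l => ?_
      rw [coeff_C]
      split_ifs with hl
      · rw [hl]
      · rw [← hcoll, coeff_collect hρ, ← wordCoeffs_mul]
        refine apply_eq_zero_of_mem_supportedIn hshort fun h => ?_
        rw [extendWord_of_ne_zero _ _ hl] at h
        exact absurd h (by simp [shortWords])
    set γ := ((a * b) %ₘ edgePoly (M c d)).coeff 0 with hγ
    have hγ0 : γ ≠ 0 := by
      intro h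
      rw [h, map_zero] at hconst
      exact hab hconst
    have heven := even_iff_of_zero_mem_support_mul ha_par hb_par (mem_support_iff.2 hγ0)
    -- Runs in a lead from c to j and those in b have the same parity, so they lead from j back to
    -- c.
    have hvert : ∀ l ∈ b.support, altVertex j j' l = c ∧ altVertex j' j l = d := by
      intro l hl
      have h1 := heven k₀ ha_supp l hl
      have h2 := mk_altVertex c d k₀
      rw [ha_vert k₀ ha_supp] at h2
      have h3 := Sym2.congr_right.1 (h2.trans he)
      rw [← ha_vert k₀ ha_supp, ← h3, altVertex_altVertex, altVertex_altVertex]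
      have h4 : Even (k₀ + l) := Nat.even_add.2 h1
      exact ⟨if_pos h4, if_pos h4⟩
    have hprod : M.toStrict (M.altPoly j j' b) * M.toStrict (M.altPoly c d a) =
        γ • M.toStrict (PathAlgebra.vertex ℤ j) := by
      rw [← map_mul, altPoly_mul_altPoly hvert, mul_comm b a, ← toStrict_altPoly_mod hjj', ← hM,
        hconst, ← map_zsmul]
      refine congrArg _ ?_
      rw [← mul_one (C γ), ← smul_eq_C_mul, map_zsmul, ← pow_zero X, altPoly_X_pow]
      rfl
    have hxzy : x * M.toStrict (M.altPoly j j' b) * M.toStrict (M.altPoly c d a) = γ • x := by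
      rw [mul_assoc, hprod, mul_smul_comm, hxj]
    have hzyy : M.toStrict (M.altPoly j j' b) * (M.toStrict (M.altPoly c d a) * y) = γ • y := by
      rw [← mul_assoc, hprod, smul_mul_assoc, hjy]
    -- The new bounds satisfy |u₀| < n and |v₀| + 1 ≤ m, so their sum drops.
    have hfinal := ih (i := i) (j := c) (k := k) (n := u₀.length) (m := v₀.length + 1)
      (x := x * M.toStrict (M.altPoly j j' b)) (y := M.toStrict (M.altPoly c d a) * y)
      (by omega) (by rw [← mul_assoc, hix])
      (by rw [mul_assoc, ← map_mul, altPoly_mul_vertex fun l hl => (hvert l hl).1])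
      (by rw [← mul_assoc, ← map_mul, vertex_mul_altPoly]) (by rw [mul_assoc, hyk]) hshort
      (wordCoeffs_altPoly_mul_mem hu.adj he a hjy (fun q hq => (hgn hq).1) hge)
      (by rw [← mul_assoc, hxzy, smul_mul_assoc, hxy, smul_zero])
    rcases hfinal with h | h
    · rw [h, zero_mul] at hxzy
      exact zsmul_ne_zero_of_vertex_mul hix hx0 hγ0 hxzy.symm
    · rw [h, mul_zero] at hzyy
      exact zsmul_ne_zero_of_vertex_mul hjy hy0 hγ0 hzyy.symm

end CoxeterMatrix

end

theorem mainTheorem1 {B : Type*} {M : CoxeterMatrix B} {W : Type*} [Group W]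
    (cs : CoxeterSystem M W) (i j k : B) (x₁ x₂ : cs.StrictRing)
    (hx₁ : x₁ ∈ cs.peirce i j) (hx₂ : x₂ ∈ cs.peirce j k) (h : x₁ * x₂ = 0) :
    x₁ = 0 ∨ x₂ = 0 := by
  have hid : ∀ a : B, M.toStrict (PathAlgebra.vertex ℤ a) * M.toStrict (PathAlgebra.vertex ℤ a) =
      M.toStrict (PathAlgebra.vertex ℤ a) := fun a => by
    rw [← map_mul, PathAlgebra.vertex_idem a]
  have hl : ∀ (a b : B) (x : cs.StrictRing), x ∈ cs.peirce a b →
      M.toStrict (PathAlgebra.vertex ℤ a) * x = x := by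
    rintro a b x ⟨r, rfl⟩
    change _ * (M.toStrict (PathAlgebra.vertex ℤ a) * r * _) =
      M.toStrict (PathAlgebra.vertex ℤ a) * r * _
    rw [← mul_assoc, ← mul_assoc, hid]
  have hr : ∀ (a b : B) (x : cs.StrictRing), x ∈ cs.peirce a b →
      x * M.toStrict (PathAlgebra.vertex ℤ b) = x := by
    rintro a b x ⟨r, rfl⟩
    change _ * M.toStrict (PathAlgebra.vertex ℤ b) * M.toStrict (PathAlgebra.vertex ℤ b) =
      _ * M.toStrict (PathAlgebra.vertex ℤ b)
    rw [mul_assoc, hid]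
  have hshort : ∀ f : WordModule B, ∃ n, f ∈ supportedIn (shortWords B n) := fun f =>
    ⟨f.support.sup List.length, fun _ hw => Finset.le_sup (f := List.length) hw⟩
  obtain ⟨n, hn⟩ := hshort (CoxeterMatrix.wordCoeffs i x₁)
  obtain ⟨m, hm⟩ := hshort (CoxeterMatrix.wordCoeffs j x₂)
  exact CoxeterMatrix.eq_zero_or_eq_zero_of_mul_eq_zero_of_length_lt (n + m + 1) (Nat.lt_succ_self _)
    (hl i j x₁ hx₁) (hr i j x₁ hx₁) (hl j k x₂ hx₂) (hr j k x₂ hx₂) hn hm h
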